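/- Let $\mathcal H$ and $\mathcal E$ be complex Hilbert spaces (inner products linear in the first argument), let $A_0$ be a self-adjoint operator in $\mathcal H$ with $0\in\rho(A_0)$, let $\Lambda$ be a self-adjoint operator in $\mathcal E$, and let $\Pi:\mathcal E\to\mathcal H$ be a bounded operator with $\ker\Pi=\{0\}$ and $\operatorname{dom}(A_0)\cap\operatorname{ran}(\Pi)=\{0\}$. Define linear operators by $$A:\ A_0^{-1}f+\Pi\phi\mapsto f,\qquad \Gamma_0:\ A_0^{-1}f+\Pi\phi\mapsto\phi\qquad (f\in\mathcal H,\ \phi\in\mathcal E),$$ $$\Gamma_1:\ A_0^{-1}f+\Pi\phi\mapsto\Pi^*f+\Lambda\phi\qquad (f\in\mathcal H,\ \phi\in\operatorname{dom}(\Lambda)),$$ and, for $z\in\rho(A_0)$, put $\gamma(z)=(I+z(A_0-zI)^{-1})\Pi$ and $M(z)=\Gamma_1\gamma(z)$ with $\operatorname{dom}(M(z))=\operatorname{dom}(\Lambda)$. Let $L$ be the restriction of $A$ to $\{u\in\operatorname{dom}(\Gamma_1):\Gamma_1u-\mathrm i\Gamma_0u=0\}$. In the Hilbert space $$\mathscr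 H:=L^2(\mathbb R_-,\mathcal E)\oplus\mathcal H\oplus L^2(\mathbb R_+,\mathcal E),$$ where $\mathcal H$ is identified with $\{0\}\oplus\mathcal H\oplus\{0\}$ and $P_{\mathcal H}$ denotes the orthogonal projection onto $\mathcal H$, let $\mathscr A(v_-,u,v_+):=(\mathrm i v_-',Au,\mathrm i v_+')$ on the domain of all $(v_-,u,v_+)\in\mathscr H$ such that $v_\pm\in W_2^1(\mathbb R_\pm,\mathcal E)$, $u\in\operatorname{dom}(\Gamma_1)$ and $\Gamma_1u\pm\mathrm i\Gamma_0u=\sqrt2\,v_\pm(0)$. Then $L$ is densely defined, $\operatorname{Im}\langle Lu,u\rangle\ge0$ for all $u\in\operatorname{dom}(L)$ and $\mathbb C_-\subset\rho(L)$ (that is, $L$ is maximal dissipative); for all $z\in\mathbb C_-$ the operator $M(z)-\mathrm iI$ is boundedly invertible and $$(L-zI)^{-1}=(A_0-zI)^{-1}-\gamma(z)\bigl(M(z)-\mathrm iI\bigr)^{-1}\gamma(\bar z)^*;$$ and $\mathscr A$ is a minimal self-adjoint dilation of $L$, that is: 1. $\mathscr A$ is self-adjoint in $\mathscr H$; 2.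 $P_{\mathcal H}(\mathscr A-zI)^{-1}\big|_{\mathcal H}=(L-zI)^{-1}$ for all $z\in\mathbb C_-$; 3. the linear span of $\{(\mathscr A-zI)^{-1}h:\ z\in\mathbb C\setminus\mathbb R,\ h\in\mathcal H\}$ is dense in $\mathscr H$. -/

import Mathlib

open MeasureTheory Set
open scoped ENNReal ContDiff InnerProductSpace ComplexConjugate

noncomputable section

namespace BVPModel

/-! ### Resolvents of unbounded operators -/

section Resolvents

variable {X : Type*} [NormedAddCommGroup X] [NormedSpace ℂ X]

/-- The bounded everywhere defined operator `R` is a two-sided inverse of `T - z`. -/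
def IsResolventAt (T : X →ₗ.[ℂ] X) (z : ℂ) (R : X →L[ℂ] X) : Prop :=
  (∀ x : X, ∃ hx : R x ∈ T.domain, T ⟨R x, hx⟩ - z • R x = x) ∧
    ∀ u : T.domain, R (T u - z • (u : X)) = u

/-- The resolvent set `ρ(T)`. -/
def resSet (T : X →ₗ.[ℂ] X) : Set ℂ := {z | ∃ R : X →L[ℂ] X, IsResolventAt T z R}

open Classical in
/-- The resolvent `(T - z)⁻¹` for `z ∈ ρ(T)` (and `0` for `z ∉ ρ(T)`). -/
def res (T : X →ₗ.[ℂ] X) (z : ℂ) : X →L[ℂ] X :=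
  if h : z ∈ resSet T then h.choose else 0

theorem isResolventAt_res {T : X →ₗ.[ℂ] X} {z : ℂ} (h : z ∈ resSet T) :
    IsResolventAt T z (res T z) := by
  rw [res, dif_pos h]
  exact h.choose_spec

theorem IsResolventAt.eq_res {T : X →ₗ.[ℂ] X} {z : ℂ} {R : X →L[ℂ] X}
    (h : IsResolventAt T z R) : R = res T z := by
  have h' := isResolventAt_res (T := T) (z := z) ⟨R, h⟩
  ext x
  obtain ⟨hx, hx'⟩ := h'.1 x
  have := h.2 ⟨_, hx⟩
  rwa [hx'] at this

theorem res_mem_domain (T : X →ₗ.[ℂ] X) (z : ℂ) (x : X) : res T z x ∈ T.domain := by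
  by_cases h : z ∈ resSet T
  · exact ((isResolventAt_res h).1 x).1
  · rw [res, dif_neg h]
    exact T.domain.zero_mem

theorem apply_mk_eq_zero {Y Z : Type*} [AddCommGroup Y] [Module ℂ Y] [AddCommGroup Z] [Module ℂ Z]
    (T : Y →ₗ.[ℂ] Z) {x : Y} (hx : x ∈ T.domain) (h : x = 0) : T ⟨x, hx⟩ = 0 := by
  subst h
  exact T.map_zero

end Resolvents

/-! ### Dissipative operators and their dilations -/

section Dilations

variable {X K : Type*} [NormedAddCommGroup X] [InnerProductSpace ℂ X]
  [NormedAddCommGroup K] [InnerProductSpace ℂ K]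

/-- `T` is densely defined, dissipative, and the open lower half-plane lies in `ρ(T)`. -/
def IsMaximalDissipative (T : X →ₗ.[ℂ] X) : Prop :=
  Dense (T.domain : Set X) ∧ (∀ u : T.domain, 0 ≤ (⟪(u : X), T u⟫_ℂ).im) ∧
    {z : ℂ | z.im < 0} ⊆ resSet T

/-- `𝒜`, an operator in `K`, is a self-adjoint dilation of `T`, where `X` is regarded as a closed
subspace of `K` by means of the isometry `ι`. The adjoint of `ι` is the orthogonal projection of
`K` onto `X`. -/
def IsSelfAdjointDilation [CompleteSpace X] [CompleteSpace K] (ι : X →ₗᵢ[ℂ] K)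
    (𝒜 : K →ₗ.[ℂ] K) (T : X →ₗ.[ℂ] X) : Prop :=
  IsSelfAdjoint 𝒜 ∧ ∀ z : ℂ, z.im < 0 → z ∈ resSet 𝒜 ∧ z ∈ resSet T ∧
    ∀ h : X, ContinuousLinearMap.adjoint ι.toContinuousLinearMap (res 𝒜 z (ι h)) =
      res T z h

/-- Every non-real `z` lies in `ρ(𝒜)`, and the linear span of the vectors `(𝒜 - z)⁻¹ ι h`,
`z ∈ ℂ \ ℝ`, `h ∈ X`, is dense in `K`. -/
def IsMinimalOver (ι : X →ₗᵢ[ℂ] K) (𝒜 : K →ₗ.[ℂ] K) : Prop :=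
  (∀ z : ℂ, z.im ≠ 0 → z ∈ resSet 𝒜) ∧
    (Submodule.span ℂ {x : K | ∃ z : ℂ, z.im ≠ 0 ∧ ∃ h : X, x = res 𝒜 z (ι h)}
      ).topologicalClosure = ⊤

end Dilations

/-! ### Triples for abstract boundary-value problems -/

section Triples

variable {H E : Type*} [NormedAddCommGroup H] [InnerProductSpace ℂ H] [CompleteSpace H]
  [NormedAddCommGroup E] [InnerProductSpace ℂ E] [CompleteSpace E]

/-- A triple `(A₀, Π, Λ)`; the operator `Π : E → H` is called `lift`. -/
structure Triple (H E : Type*) [NormedAddCommGroup H] [InnerProductSpace ℂ H] [CompleteSpace H]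
    [NormedAddCommGroup E] [InnerProductSpace ℂ E] [CompleteSpace E] where
  A₀ : H →ₗ.[ℂ] H
  lift : E →L[ℂ] H
  Λ : E →ₗ.[ℂ] E
  isSelfAdjoint_A₀ : IsSelfAdjoint A₀
  zero_mem_resSet : (0 : ℂ) ∈ resSet A₀
  domain_inf_range : A₀.domain ⊓ LinearMap.range (lift : E →ₗ[ℂ] H) = ⊥
  ker_lift : LinearMap.ker (lift : E →ₗ[ℂ] H) = ⊥
  isSelfAdjoint_Λ : IsSelfAdjoint Λ

namespace Triple

variable (t : Triple H E)

/-- The bounded operator `A₀⁻¹`. -/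
def A₀inv : H →L[ℂ] H := res t.A₀ 0

theorem A₀inv_mem (f : H) : t.A₀inv f ∈ t.A₀.domain := res_mem_domain _ _ _

theorem A₀_A₀inv (f : H) : t.A₀ ⟨t.A₀inv f, t.A₀inv_mem f⟩ = f := by
  obtain ⟨_, h⟩ := (isResolventAt_res t.zero_mem_resSet).1 f
  rwa [zero_smul, sub_zero] at h

theorem A₀inv_A₀ (u : t.A₀.domain) : t.A₀inv (t.A₀ u) = u := by
  have h := (isResolventAt_res t.zero_mem_resSet).2 u
  rwa [zero_smul, sub_zero] at h

theorem decomp_unique {f : H} {φ : E} (h : t.A₀inv f + t.lift φ = 0) : f = 0 ∧ φ = 0 := by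
  have h1 : t.lift φ = t.A₀inv (-f) := by
    rw [map_neg]; exact (neg_eq_of_add_eq_zero_right h).symm
  have h2 : t.lift φ ∈ t.A₀.domain ⊓ LinearMap.range (t.lift : E →ₗ[ℂ] H) :=
    ⟨h1 ▸ t.A₀inv_mem _, ⟨φ, rfl⟩⟩
  rw [t.domain_inf_range, Submodule.mem_bot] at h2
  have h3 : φ ∈ LinearMap.ker (t.lift : E →ₗ[ℂ] H) := h2
  rw [t.ker_lift, Submodule.mem_bot] at h3
  have h4 : t.A₀inv f = 0 := by simpa [h2] using h
  refine ⟨?_, h3⟩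
  rw [← t.A₀_A₀inv f]
  have : (⟨t.A₀inv f, t.A₀inv_mem f⟩ : t.A₀.domain) = 0 := Subtype.ext h4
  rw [this, LinearPMap.map_zero]

/-- The set of all pairs `(A₀⁻¹ f + Π φ, f)`. -/
def graphA : Submodule ℂ (H × H) :=
  LinearMap.range (((t.A₀inv : H →ₗ[ℂ] H).coprod (t.lift : E →ₗ[ℂ] H)).prod (LinearMap.fst ℂ H E))

/-- The set of all pairs `(A₀⁻¹ f + Π φ, φ)`. -/
def graphΓ₀ : Submodule ℂ (H × E) :=
  LinearMap.range (((t.A₀inv : H →ₗ[ℂ] H).coprod (t.lift : E →ₗ[ℂ] H)).prod (LinearMap.snd ℂ H E))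

/-- The set of all pairs `(A₀⁻¹ f + Π φ, Π* f + Λ φ)` with `φ ∈ dom Λ`. -/
def graphΓ₁ : Submodule ℂ (H × E) :=
  LinearMap.range
    (((t.A₀inv : H →ₗ[ℂ] H).coprod ((t.lift : E →ₗ[ℂ] H) ∘ₗ t.Λ.domain.subtype)).prod
      ((ContinuousLinearMap.adjoint t.lift : H →ₗ[ℂ] E).coprod t.Λ.toFun))

/-- `A : A₀⁻¹ f + Π φ ↦ f`, the null extension of `A₀` to `dom A₀ ∔ ran Π`. -/
def A : H →ₗ.[ℂ] H := t.graphA.toLinearPMap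

/-- `Γ₀ : A₀⁻¹ f + Π φ ↦ φ` on `dom A₀ ∔ ran Π`. -/
def Γ₀ : H →ₗ.[ℂ] E := t.graphΓ₀.toLinearPMap

/-- `Γ₁ : A₀⁻¹ f + Π φ ↦ Π* f + Λ φ` on `dom A₀ ∔ Π dom Λ`. -/
def Γ₁ : H →ₗ.[ℂ] E := t.graphΓ₁.toLinearPMap

theorem mem_graph_A {u f : H} : (u, f) ∈ t.A.graph ↔ ∃ φ : E, u = t.A₀inv f + t.lift φ := by
  rw [A, Submodule.toLinearPMap_graph_eq]
  · simp only [graphA, LinearMap.mem_range, Prod.exists]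
    constructor
    · rintro ⟨g, φ, h⟩
      simp only [LinearMap.prod_apply, Function.prod_apply, LinearMap.coprod_apply, LinearMap.fst_apply, Prod.mk.injEq] at h
      obtain ⟨h1, rfl⟩ := h
      exact ⟨φ, h1.symm⟩
    · rintro ⟨φ, rfl⟩
      exact ⟨f, φ, rfl⟩
  · rintro x ⟨⟨g, φ⟩, rfl⟩ h
    exact (t.decomp_unique h).1

theorem mem_graph_Γ₀ {u : H} {φ : E} :
    (u, φ) ∈ t.Γ₀.graph ↔ ∃ f : H, u = t.A₀inv f + t.lift φ := by
  rw [Γ₀, Submodule.toLinearPMap_graph_eq]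
  · simp only [graphΓ₀, LinearMap.mem_range, Prod.exists]
    constructor
    · rintro ⟨g, φ, h⟩
      simp only [LinearMap.prod_apply, Function.prod_apply, LinearMap.coprod_apply, LinearMap.snd_apply, Prod.mk.injEq] at h
      obtain ⟨h1, rfl⟩ := h
      exact ⟨g, h1.symm⟩
    · rintro ⟨f, rfl⟩
      exact ⟨f, φ, rfl⟩
  · rintro x ⟨⟨g, φ⟩, rfl⟩ h
    exact (t.decomp_unique h).2

theorem mem_graph_Γ₁ {u : H} {e : E} :
    (u, e) ∈ t.Γ₁.graph ↔ ∃ (f : H) (φ : t.Λ.domain), u = t.A₀inv f + t.lift φ ∧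
      e = ContinuousLinearMap.adjoint t.lift f + t.Λ φ := by
  rw [Γ₁, Submodule.toLinearPMap_graph_eq]
  · simp only [graphΓ₁, LinearMap.mem_range, Prod.exists]
    constructor
    · rintro ⟨g, φ, h⟩
      obtain ⟨h1, h2⟩ := Prod.ext_iff.1 h
      exact ⟨g, φ, h1.symm, h2.symm⟩
    · rintro ⟨f, φ, rfl, rfl⟩
      exact ⟨f, φ, rfl⟩
  · rintro x ⟨⟨g, φ⟩, rfl⟩ h
    obtain ⟨rfl, h2⟩ := t.decomp_unique (f := g) (φ := φ) h
    obtain rfl : φ = 0 := Subtype.ext h2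
    exact map_zero _ |>.trans rfl

theorem mem_domain_A {u : H} :
    u ∈ t.A.domain ↔ ∃ (f : H) (φ : E), u = t.A₀inv f + t.lift φ := by
  rw [LinearPMap.mem_domain_iff]
  exact exists_congr fun f => t.mem_graph_A

theorem mem_domain_Γ₀ {u : H} :
    u ∈ t.Γ₀.domain ↔ ∃ (f : H) (φ : E), u = t.A₀inv f + t.lift φ := by
  rw [LinearPMap.mem_domain_iff, exists_comm]
  exact exists_congr fun φ => t.mem_graph_Γ₀

theorem mem_domain_Γ₁ {u : H} :
    u ∈ t.Γ₁.domain ↔ ∃ (f : H) (φ : t.Λ.domain), u = t.A₀inv f + t.lift φ := by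
  rw [LinearPMap.mem_domain_iff]
  constructor
  · rintro ⟨e, he⟩
    obtain ⟨f, φ, h, -⟩ := t.mem_graph_Γ₁.1 he
    exact ⟨f, φ, h⟩
  · rintro ⟨f, φ, h⟩
    exact ⟨_, t.mem_graph_Γ₁.2 ⟨f, φ, h, rfl⟩⟩

theorem Γ₁_domain_le_A : t.Γ₁.domain ≤ t.A.domain := fun _ hu =>
  let ⟨f, φ, h⟩ := t.mem_domain_Γ₁.1 hu
  t.mem_domain_A.2 ⟨f, φ, h⟩

theorem Γ₁_domain_le_Γ₀ : t.Γ₁.domain ≤ t.Γ₀.domain := fun _ hu =>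
  let ⟨f, φ, h⟩ := t.mem_domain_Γ₁.1 hu
  t.mem_domain_Γ₀.2 ⟨f, φ, h⟩

/-- The solution operator `γ(z) = (I + z (A₀ - z)⁻¹) Π`, `z ∈ ρ(A₀)`. -/
def γ (z : ℂ) : E →L[ℂ] H :=
  (ContinuousLinearMap.id ℂ H + z • res t.A₀ z) ∘L t.lift

theorem γ_mem (z : ℂ) (φ : t.Λ.domain) : t.γ z φ ∈ t.Γ₁.domain := by
  refine t.mem_domain_Γ₁.2
    ⟨t.A₀ ⟨_, t.A₀.domain.smul_mem z (res_mem_domain t.A₀ z (t.lift φ))⟩, φ, ?_⟩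
  rw [A₀inv_A₀]
  simp [γ, add_comm]

/-- The `M`-function: `M(z) = Γ₁ γ(z)` with `dom M(z) = dom Λ`. -/
def M (z : ℂ) : E →ₗ.[ℂ] E where
  domain := t.Λ.domain
  toFun := t.Γ₁.toFun ∘ₗ
    ((t.γ z : E →ₗ[ℂ] H) ∘ₗ t.Λ.domain.subtype).codRestrict t.Γ₁.domain (t.γ_mem z)

/-- The operator `L`: the restriction of `A` to the vectors `u ∈ dom Γ₁` with
`Γ₁ u - i Γ₀ u = 0`. -/
def L : H →ₗ.[ℂ] H :=
  t.A.domRestrict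
    ((LinearMap.ker (t.Γ₁.toFun - Complex.I •
      t.Γ₀.toFun ∘ₗ Submodule.inclusion t.Γ₁_domain_le_Γ₀)).map t.Γ₁.domain.subtype)

theorem mem_domain_L {u : H} : u ∈ t.L.domain ↔ ∃ hu : u ∈ t.Γ₁.domain,
    t.Γ₁ ⟨u, hu⟩ - Complex.I • t.Γ₀ ⟨u, t.Γ₁_domain_le_Γ₀ hu⟩ = 0 := by
  constructor
  · rintro ⟨⟨⟨v, hv⟩, hv', rfl⟩, -⟩
    exact ⟨hv, hv'⟩
  · rintro ⟨hu, h⟩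
    exact ⟨⟨⟨u, hu⟩, h, rfl⟩, t.Γ₁_domain_le_A hu⟩

end Triple

end Triples

/-! ### Vector-valued Sobolev functions on an interval -/

section Sobolev

set_option linter.unusedSectionVars false

variable {E : Type*} [NormedAddCommGroup E] [InnerProductSpace ℂ E]

/-- `L²(I; E)`. -/
abbrev L2 (E : Type*) [NormedAddCommGroup E] (I : Set ℝ) : Type _ :=
  Lp E 2 ((volume : Measure ℝ).restrict I)

/-- `v` belongs to the Sobolev space `W₂¹(I; E)` and `w` is its weak derivative. -/
def HasWeakDeriv {I : Set ℝ} (v w : L2 E I) : Prop :=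
  ∀ φ : ℝ → ℝ, ContDiff ℝ ∞ φ → HasCompactSupport φ → tsupport φ ⊆ I →
    ∫ x in I, deriv φ x • v x = -∫ x in I, φ x • w x

/-- The representative of `v` that is continuous on the closure of `I` takes the value `e` at
the point `0`. -/
def HasBoundaryValue {I : Set ℝ} (v : L2 E I) (e : E) : Prop :=
  ∃ g : ℝ → E, ContinuousOn g (closure I) ∧ v =ᵐ[volume.restrict I] g ∧ g 0 = e

theorem integrable_test_smul {I : Set ℝ} {φ : ℝ → ℝ} (h : Continuous φ)
    (hc : HasCompactSupport φ) (v : L2 E I) :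
    Integrable (fun x => φ x • v x) (volume.restrict I) :=
  ((Lp.memLp v).locallyIntegrable (by norm_num)).integrable_smul_left_of_hasCompactSupport h hc

theorem integral_test_smul_add {I : Set ℝ} {φ : ℝ → ℝ} (h : Continuous φ)
    (hc : HasCompactSupport φ) (v w : L2 E I) :
    ∫ x in I, φ x • (v + w) x = (∫ x in I, φ x • v x) + ∫ x in I, φ x • w x := by
  rw [← integral_add (integrable_test_smul h hc v) (integrable_test_smul h hc w)]
  refine integral_congr_ae ?_
  filter_upwards [Lp.coeFn_add v w] with x hx
  rw [hx, Pi.add_apply, smul_add]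

theorem integral_test_smul_smul {I : Set ℝ} (φ : ℝ → ℝ) (c : ℂ) (v : L2 E I) :
    ∫ x in I, φ x • (c • v) x = c • ∫ x in I, φ x • v x := by
  rw [← integral_smul]
  refine integral_congr_ae ?_
  filter_upwards [Lp.coeFn_smul c v] with x hx
  rw [hx, Pi.smul_apply, smul_comm]

theorem HasWeakDeriv.add {I : Set ℝ} {v w v' w' : L2 E I} (h : HasWeakDeriv v w)
    (h' : HasWeakDeriv v' w') : HasWeakDeriv (v + v') (w + w') := by
  intro φ hφ hc hs
  have hd : Continuous (deriv φ) := hφ.continuous_deriv (by simp)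
  rw [integral_test_smul_add hd hc.deriv, integral_test_smul_add hφ.continuous hc,
    h φ hφ hc hs, h' φ hφ hc hs, neg_add]

theorem HasWeakDeriv.smul {I : Set ℝ} {v w : L2 E I} (c : ℂ) (h : HasWeakDeriv v w) :
    HasWeakDeriv (c • v) (c • w) := by
  intro φ hφ hc hs
  rw [integral_test_smul_smul, integral_test_smul_smul, h φ hφ hc hs, smul_neg]

theorem HasWeakDeriv.zero {I : Set ℝ} : HasWeakDeriv (0 : L2 E I) 0 := by
  intro φ _ _ _
  have h : ∀ ψ : ℝ → ℝ, ∫ x in I, ψ x • (0 : L2 E I) x = 0 := fun ψ => by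
    have := integral_test_smul_smul ψ 0 (0 : L2 E I)
    rwa [zero_smul, zero_smul] at this
  rw [h, h, neg_zero]

theorem HasWeakDeriv.eq_zero [CompleteSpace E] {I : Set ℝ} (hI : IsOpen I) {w : L2 E I}
    (h : HasWeakDeriv 0 w) : w = 0 := by
  have h0 : ∀ ψ : ℝ → ℝ, ∫ x in I, ψ x • (0 : L2 E I) x = 0 := fun ψ => by
    have := integral_test_smul_smul ψ 0 (0 : L2 E I)
    rwa [zero_smul, zero_smul] at this
  have key : ∀ᵐ x ∂(volume.restrict I), x ∈ I → w x = 0 := by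
    refine hI.ae_eq_zero_of_integral_contDiff_smul_eq_zero
      (((Lp.memLp w).locallyIntegrable (by norm_num)).locallyIntegrableOn I) ?_
    intro φ hφ hc hs
    have := h φ hφ hc hs
    rw [h0] at this
    exact neg_eq_zero.1 this.symm
  refine (Lp.eq_zero_iff_ae_eq_zero).2 ?_
  filter_upwards [key, ae_restrict_mem hI.measurableSet] with x hx hxI using hx hxI

theorem HasBoundaryValue.add {I : Set ℝ} {v v' : L2 E I} {e e' : E} (h : HasBoundaryValue v e)
    (h' : HasBoundaryValue v' e') : HasBoundaryValue (v + v') (e + e') := by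
  obtain ⟨g, hg, hv, rfl⟩ := h
  obtain ⟨g', hg', hv', rfl⟩ := h'
  exact ⟨g + g', hg.add hg', (Lp.coeFn_add v v').trans (hv.add hv'), rfl⟩

theorem HasBoundaryValue.smul {I : Set ℝ} {v : L2 E I} {e : E} (c : ℂ)
    (h : HasBoundaryValue v e) : HasBoundaryValue (c • v) (c • e) := by
  obtain ⟨g, hg, hv, rfl⟩ := h
  exact ⟨c • g, hg.const_smul c, (Lp.coeFn_smul c v).trans (hv.const_smul c), rfl⟩

theorem HasBoundaryValue.zero {I : Set ℝ} : HasBoundaryValue (0 : L2 E I) 0 :=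
  ⟨0, continuousOn_const, Lp.coeFn_zero _ _ _, rfl⟩

end Sobolev

/-! ### The dilation -/

section Dilation

/-- The Hilbert space `L²(ℝ₋; E) ⊕ H ⊕ L²(ℝ₊; E)`. -/
abbrev DilationSpace (H E : Type*) [NormedAddCommGroup H] [InnerProductSpace ℂ H]
    [NormedAddCommGroup E] [InnerProductSpace ℂ E] : Type _ :=
  WithLp 2 (L2 E (Iio 0) × WithLp 2 (H × L2 E (Ioi 0)))

/-- The vector `(v₋, u, v₊)`. -/
abbrev vec {H E : Type*} [NormedAddCommGroup H] [InnerProductSpace ℂ H]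
    [NormedAddCommGroup E] [InnerProductSpace ℂ E]
    (vm : L2 E (Iio 0)) (u : H) (vp : L2 E (Ioi 0)) : DilationSpace H E :=
  WithLp.toLp 2 (vm, WithLp.toLp 2 (u, vp))

/-- The embedding `u ↦ (0, u, 0)`. -/
def embed (H E : Type*) [NormedAddCommGroup H] [InnerProductSpace ℂ H]
    [NormedAddCommGroup E] [InnerProductSpace ℂ E] : H →ₗᵢ[ℂ] DilationSpace H E where
  toFun u := vec 0 u 0
  map_add' u v := by simp [vec, ← WithLp.toLp_add]
  map_smul' c u := by simp [vec, ← WithLp.toLp_smul]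
  norm_map' u := by simp [vec]

variable {H E : Type*} [NormedAddCommGroup H] [InnerProductSpace ℂ H] [CompleteSpace H]
  [NormedAddCommGroup E] [InnerProductSpace ℂ E] [CompleteSpace E]

namespace Triple

variable (t : Triple H E)

/-- The graph of the operator `𝒜 : (v₋, u, v₊) ↦ (i v₋', A u, i v₊')` whose domain consists of the
vectors with `v₋ ∈ W₂¹(ℝ₋; E)`, `v₊ ∈ W₂¹(ℝ₊; E)`, `u ∈ dom Γ₁`,
`Γ₁ u - i Γ₀ u = √2 v₋(0)` and `Γ₁ u + i Γ₀ u = √2 v₊(0)`. Here `wm`, `wp` are the weak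
derivatives of `v₋`, `v₊`, and `em`, `ep` their values at `0`. -/
def dilationGraph : Submodule ℂ (DilationSpace H E × DilationSpace H E) where
  carrier := {p | ∃ (wm : L2 E (Iio 0)) (wp : L2 E (Ioi 0)) (em ep : E)
    (hu : p.1.snd.fst ∈ t.Γ₁.domain),
    HasWeakDeriv p.1.fst wm ∧ HasBoundaryValue p.1.fst em ∧
    HasWeakDeriv p.1.snd.snd wp ∧ HasBoundaryValue p.1.snd.snd ep ∧
    t.Γ₁ ⟨p.1.snd.fst, hu⟩ - Complex.I • t.Γ₀ ⟨p.1.snd.fst, t.Γ₁_domain_le_Γ₀ hu⟩ =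
      (Real.sqrt 2 : ℂ) • em ∧
    t.Γ₁ ⟨p.1.snd.fst, hu⟩ + Complex.I • t.Γ₀ ⟨p.1.snd.fst, t.Γ₁_domain_le_Γ₀ hu⟩ =
      (Real.sqrt 2 : ℂ) • ep ∧
    p.2 = vec (Complex.I • wm) (t.A ⟨p.1.snd.fst, t.Γ₁_domain_le_A hu⟩) (Complex.I • wp)}
  zero_mem' := by
    have hz : (0 : DilationSpace H E).snd.fst = 0 := rfl
    have hu : (0 : DilationSpace H E).snd.fst ∈ t.Γ₁.domain := hz ▸ zero_mem _
    have e1 := apply_mk_eq_zero t.Γ₁ hu hz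
    have e0 := apply_mk_eq_zero t.Γ₀ (t.Γ₁_domain_le_Γ₀ hu) hz
    have e2 := apply_mk_eq_zero t.A (t.Γ₁_domain_le_A hu) hz
    refine ⟨0, 0, 0, 0, hu, HasWeakDeriv.zero, HasBoundaryValue.zero, HasWeakDeriv.zero,
      HasBoundaryValue.zero, ?_, ?_, ?_⟩
    · change t.Γ₁ ⟨(0 : DilationSpace H E).snd.fst, _⟩ -
        Complex.I • t.Γ₀ ⟨(0 : DilationSpace H E).snd.fst, _⟩ = _
      rw [e1, e0, smul_zero, smul_zero, sub_zero]
    · change t.Γ₁ ⟨(0 : DilationSpace H E).snd.fst, _⟩ +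
        Complex.I • t.Γ₀ ⟨(0 : DilationSpace H E).snd.fst, _⟩ = _
      rw [e1, e0, smul_zero, smul_zero, add_zero]
    · change 0 = vec _ (t.A ⟨(0 : DilationSpace H E).snd.fst, _⟩) _
      rw [e2, smul_zero, smul_zero]
      rfl
  add_mem' := by
    rintro ⟨p, p'⟩ ⟨q, q'⟩ ⟨wm, wp, em, ep, hu, h1, h2, h3, h4, h5, h6, h7⟩
      ⟨xm, xp, fm, fp, hv, k1, k2, k3, k4, k5, k6, k7⟩
    have e1 : t.Γ₁ ⟨(p + q).snd.fst, add_mem hu hv⟩ = _ := t.Γ₁.map_add ⟨_, hu⟩ ⟨_, hv⟩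
    have e0 : t.Γ₀ ⟨(p + q).snd.fst, t.Γ₁_domain_le_Γ₀ (add_mem hu hv)⟩ = _ :=
      t.Γ₀.map_add ⟨_, t.Γ₁_domain_le_Γ₀ hu⟩ ⟨_, t.Γ₁_domain_le_Γ₀ hv⟩
    have e2 : t.A ⟨(p + q).snd.fst, t.Γ₁_domain_le_A (add_mem hu hv)⟩ = _ :=
      t.A.map_add ⟨_, t.Γ₁_domain_le_A hu⟩ ⟨_, t.Γ₁_domain_le_A hv⟩
    refine ⟨wm + xm, wp + xp, em + fm, ep + fp, add_mem hu hv, h1.add k1, h2.add k2, h3.add k3,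
      h4.add k4, ?_, ?_, ?_⟩
    · change t.Γ₁ ⟨(p + q).snd.fst, _⟩ - Complex.I • t.Γ₀ ⟨(p + q).snd.fst, _⟩ = _
      rw [e1, e0, smul_add, smul_add, ← h5, ← k5]
      abel
    · change t.Γ₁ ⟨(p + q).snd.fst, _⟩ + Complex.I • t.Γ₀ ⟨(p + q).snd.fst, _⟩ = _
      rw [e1, e0, smul_add, smul_add, ← h6, ← k6]
      abel
    · change p' + q' = vec _ (t.A ⟨(p + q).snd.fst, _⟩) _
      change p' = _ at h7
      change q' = _ at k7
      rw [e2, h7, k7, smul_add, smul_add]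
      rfl
  smul_mem' := by
    rintro c ⟨p, p'⟩ ⟨wm, wp, em, ep, hu, h1, h2, h3, h4, h5, h6, h7⟩
    have e1 : t.Γ₁ ⟨(c • p).snd.fst, t.Γ₁.domain.smul_mem c hu⟩ = _ := t.Γ₁.map_smul c ⟨_, hu⟩
    have e0 : t.Γ₀ ⟨(c • p).snd.fst, t.Γ₁_domain_le_Γ₀ (t.Γ₁.domain.smul_mem c hu)⟩ = _ :=
      t.Γ₀.map_smul c ⟨_, t.Γ₁_domain_le_Γ₀ hu⟩
    have e2 : t.A ⟨(c • p).snd.fst, t.Γ₁_domain_le_A (t.Γ₁.domain.smul_mem c hu)⟩ = _ :=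
      t.A.map_smul c ⟨_, t.Γ₁_domain_le_A hu⟩
    refine ⟨c • wm, c • wp, c • em, c • ep, t.Γ₁.domain.smul_mem c hu, h1.smul c, h2.smul c,
      h3.smul c, h4.smul c, ?_, ?_, ?_⟩
    · change t.Γ₁ ⟨(c • p).snd.fst, _⟩ - Complex.I • t.Γ₀ ⟨(c • p).snd.fst, _⟩ = _
      rw [e1, e0, smul_comm _ c em, ← h5, smul_sub, smul_comm c]
    · change t.Γ₁ ⟨(c • p).snd.fst, _⟩ + Complex.I • t.Γ₀ ⟨(c • p).snd.fst, _⟩ = _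
      rw [e1, e0, smul_comm _ c ep, ← h6, smul_add, smul_comm c]
    · change c • p' = vec _ (t.A ⟨(c • p).snd.fst, _⟩) _
      change p' = _ at h7
      rw [e2, h7, smul_comm _ c wm, smul_comm _ c wp]
      rfl

/-- The operator `𝒜`, see `mem_graph_dilation`. -/
def dilation : DilationSpace H E →ₗ.[ℂ] DilationSpace H E := t.dilationGraph.toLinearPMap

theorem dilation_graph : t.dilation.graph = t.dilationGraph := by
  refine Submodule.toLinearPMap_graph_eq _ ?_
  rintro ⟨p, p'⟩ ⟨wm, wp, em, ep, hu, h1, -, h3, -, -, -, h7⟩ h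
  change p = 0 at h
  subst h
  change p' = _ at h7
  change p' = 0
  have hu0 : (0 : DilationSpace H E).snd.fst ∈ t.Γ₁.domain := hu
  have e2 := apply_mk_eq_zero t.A (t.Γ₁_domain_le_A hu0) rfl
  change p' = vec _ (t.A ⟨(0 : DilationSpace H E).snd.fst, _⟩) _ at h7
  rw [h7, e2, HasWeakDeriv.eq_zero isOpen_Iio h1,
    HasWeakDeriv.eq_zero isOpen_Ioi h3, smul_zero, smul_zero]
  rfl

theorem mem_graph_dilation {vm : L2 E (Iio 0)} {u : H} {vp : L2 E (Ioi 0)}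
    {y : DilationSpace H E} : (vec vm u vp, y) ∈ t.dilation.graph ↔
      ∃ (wm : L2 E (Iio 0)) (wp : L2 E (Ioi 0)) (em ep : E) (hu : u ∈ t.Γ₁.domain),
        HasWeakDeriv vm wm ∧ HasBoundaryValue vm em ∧
        HasWeakDeriv vp wp ∧ HasBoundaryValue vp ep ∧
        t.Γ₁ ⟨u, hu⟩ - Complex.I • t.Γ₀ ⟨u, t.Γ₁_domain_le_Γ₀ hu⟩ = (Real.sqrt 2 : ℂ) • em ∧
        t.Γ₁ ⟨u, hu⟩ + Complex.I • t.Γ₀ ⟨u, t.Γ₁_domain_le_Γ₀ hu⟩ = (Real.sqrt 2 : ℂ) • ep ∧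
        y = vec (Complex.I • wm) (t.A ⟨u, t.Γ₁_domain_le_A hu⟩) (Complex.I • wp) := by
  rw [dilation_graph]
  rfl

end Triple

end Dilation

end BVPModel

set_option linter.unusedSectionVars false

namespace BVPModel

/-! ### Unbounded operators in Hilbert spaces -/

section Operators

/-! Everything rests on Green's formula `green`: `⟪A u, v⟫ - ⟪u, A v⟫ = ⟪Γ₁ u, Γ₀ v⟫ - ⟪Γ₀ u, Γ₁
v⟫`. On the domain of `L` it gives `Im ⟪u, L u⟫ = ‖Γ₀ u‖²`, hence dissipativity.

The problem `(A - z) u = h`, `Γ₁ u - σ Γ₀ u = e` reduces to inverting `M(z) - σ = Λ + C` with `C`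
bounded and `Im ⟪y, C y⟫ = Im z ‖γ(z) y‖² - Im σ ‖y‖²`. If `Im z` and `Im σ` have opposite signs,
the two terms reinforce each other. Since `Λ` is self-adjoint, `Λ + C` is then bounded below and
onto (`perturbed_bound`, `perturbed_surjective`). For `σ = i` and `Im z < 0` this yields `ℂ₋ ⊆ ρ(L)`
and Krein's formula; density of the domain follows from surjectivity.

Integration by parts on the half-lines produces `⟪v₋(0), v₋'(0)⟫` and `-⟪v₊(0), v₊'(0)⟫` for two
domain vectors. The boundary conditions of `𝒜` are such that these cancel the right side of Green's
formula (`boundary_identity`), so `𝒜` is symmetric. Self-adjointness then needs only that `𝒜 - z` be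
onto for every non-real `z`. The function `exp(-i z x)` is square integrable on just one half-line.
The equation on the other half-line is solved first; its boundary value is the datum `e` of the
problem in `H` (`σ = i` below the real axis, `σ = -i` above), and the last component receives its
prescribed boundary value by adding an exponential. For `Im z < 0` and data in `H` one may take `v₋
= 0`, so the middle component satisfies `Γ₁ u = i Γ₀ u` and equals `(L - z)⁻¹ h`.

For minimality, let `y` be orthogonal to all `(𝒜 - z)⁻¹ h`. Each `(𝒜 - w)⁻¹ y` has zero component in
`H`, hence zero boundary values. Integration by parts makes the outer components of `y` orthogonal
to all exponentials `exp(-i w̄ x) e` that are square integrable on the half-line, and injectivity of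
the Fourier transform gives `y = 0`.

The analytic input is the du Bois-Reymond lemma, which supplies absolutely continuous
representatives, a product rule for them, and convolution with an integrable fundamental solution.
-/

theorem mem_resSet_of_bound {X : Type*} [NormedAddCommGroup X] [NormedSpace ℂ X]
    {T : X →ₗ.[ℂ] X} {z : ℂ} {c : ℝ} (hc : 0 < c)
    (hb : ∀ u : T.domain, c * ‖(u : X)‖ ≤ ‖T u - z • (u : X)‖)
    (hs : ∀ x : X, ∃ u : T.domain, T u - z • (u : X) = x) : z ∈ resSet T := by
  have inj : ∀ u v : T.domain, T u - z • (u : X) = T v - z • (v : X) → u = v := by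
    intro u v h
    have h1 := hb (u - v)
    have h2 : T (u - v) - z • ((u - v : T.domain) : X) = 0 := by
      rw [LinearPMap.map_sub, Submodule.coe_sub, smul_sub, sub_sub_sub_comm, h, sub_self]
    rw [h2, norm_zero] at h1
    have h3 : ‖((u - v : T.domain) : X)‖ = 0 :=
      le_antisymm (nonpos_of_mul_nonpos_right h1 hc) (norm_nonneg _)
    exact sub_eq_zero.1 (Subtype.ext (norm_eq_zero.1 h3))
  -- Injectivity of `T - z` makes the chosen preimages depend linearly on the data.
  choose g hg using hs
  let R : X →ₗ[ℂ] X :=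
    { toFun := fun x => g x
      map_add' := fun x y => by
        rw [← Submodule.coe_add]
        congr 1
        apply inj
        rw [hg, LinearPMap.map_add, Submodule.coe_add, smul_add, add_sub_add_comm, hg, hg]
      map_smul' := fun a x => by
        rw [RingHom.id_apply, ← Submodule.coe_smul]
        congr 1
        apply inj
        rw [hg, LinearPMap.map_smul, Submodule.coe_smul, smul_comm z a, ← smul_sub, hg] }
  have hR : ∀ x, ‖R x‖ ≤ c⁻¹ * ‖x‖ := fun x => by
    have := hb (g x)
    rw [hg] at this
    rw [inv_mul_eq_div, le_div_iff₀ hc, mul_comm]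
    exact this
  refine ⟨R.mkContinuous _ hR, fun x => ⟨(g x).2, hg x⟩, fun u => ?_⟩
  exact congrArg Subtype.val (inj _ u (hg _))

variable {X : Type*} [NormedAddCommGroup X] [InnerProductSpace ℂ X]

theorem norm_bound_of_im_inner {x y : X} {c : ℝ} (h : c * ‖x‖ ^ 2 ≤ |(⟪x, y⟫_ℂ).im|) :
    c * ‖x‖ ≤ ‖y‖ := by
  rcases eq_or_ne x 0 with rfl | hx
  · simp
  have h1 : |(⟪x, y⟫_ℂ).im| ≤ ‖x‖ * ‖y‖ := (Complex.abs_im_le_norm _).trans (norm_inner_le_norm x y)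
  have hx' : 0 < ‖x‖ := norm_pos_iff.2 hx
  nlinarith

theorem im_inner_smul_self (z : ℂ) (x : X) : (⟪x, z • x⟫_ℂ).im = z.im * ‖x‖ ^ 2 := by
  rw [inner_smul_right, inner_self_eq_norm_sq_to_K]
  simp [← Complex.ofReal_pow]

theorem im_inner_apply_eq_zero {T : X →ₗ.[ℂ] X}
    (hT : ∀ x y : T.domain, ⟪T x, (y : X)⟫_ℂ = ⟪(x : X), T y⟫_ℂ) (u : T.domain) :
    (⟪(u : X), T u⟫_ℂ).im = 0 := by
  have h := inner_conj_symm (𝕜 := ℂ) (u : X) (T u)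
  rw [hT u u] at h
  exact Complex.conj_eq_iff_im.1 h

theorem norm_bound_of_symmetric {T : X →ₗ.[ℂ] X}
    (hT : ∀ x y : T.domain, ⟪T x, (y : X)⟫_ℂ = ⟪(x : X), T y⟫_ℂ) (z : ℂ) (u : T.domain) :
    |z.im| * ‖(u : X)‖ ≤ ‖T u - z • (u : X)‖ := by
  apply norm_bound_of_im_inner
  rw [inner_sub_right, Complex.sub_im, im_inner_apply_eq_zero hT, im_inner_smul_self, zero_sub,
    abs_neg, abs_mul, abs_of_nonneg (sq_nonneg ‖(u : X)‖)]

theorem mem_resSet_of_symmetric {T : X →ₗ.[ℂ] X}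
    (hT : ∀ x y : T.domain, ⟪T x, (y : X)⟫_ℂ = ⟪(x : X), T y⟫_ℂ) {z : ℂ} (hz : z.im ≠ 0)
    (hs : ∀ x : X, ∃ u : T.domain, T u - z • (u : X) = x) : z ∈ resSet T :=
  mem_resSet_of_bound (abs_pos.2 hz) (norm_bound_of_symmetric hT z) hs

theorem symmetric_of_isSelfAdjoint [CompleteSpace X] {T : X →ₗ.[ℂ] X} (hT : IsSelfAdjoint T)
    (x y : T.domain) : ⟪T x, (y : X)⟫_ℂ = ⟪(x : X), T y⟫_ℂ := by
  have h := LinearPMap.adjoint_isFormalAdjoint hT.dense_domain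
  rw [LinearPMap.isSelfAdjoint_def.1 hT] at h
  exact h x y

theorem mem_domain_of_isSelfAdjoint [CompleteSpace X] {T : X →ₗ.[ℂ] X} (hT : IsSelfAdjoint T)
    {y w : X} (h : ∀ x : T.domain, ⟪w, (x : X)⟫_ℂ = ⟪y, T x⟫_ℂ) :
    ∃ hy : y ∈ T.domain, T ⟨y, hy⟩ = w := by
  have hy : y ∈ T.domain := by
    rw [← LinearPMap.isSelfAdjoint_def.1 hT]
    exact LinearPMap.mem_adjoint_domain_of_exists y ⟨w, h⟩
  refine ⟨hy, hT.dense_domain.eq_of_inner_left ℂ fun v hv => ?_⟩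
  rw [h ⟨v, hv⟩]
  exact symmetric_of_isSelfAdjoint hT ⟨y, hy⟩ ⟨v, hv⟩

/-- If `Im ⟪u, T u⟫` has the sign opposite to that of `Im z` and `T - z` is onto, then the
domain of `T` is dense. -/
theorem dense_domain_of_surjective [CompleteSpace X] {T : X →ₗ.[ℂ] X} {z : ℂ} (hz : z.im < 0)
    (hT : ∀ u : T.domain, 0 ≤ (⟪(u : X), T u⟫_ℂ).im)
    (hs : ∀ x : X, ∃ u : T.domain, T u - z • (u : X) = x) : Dense (T.domain : Set X) := by
  rw [Submodule.dense_iff_topologicalClosure_eq_top, Submodule.topologicalClosure_eq_top_iff,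
    Submodule.eq_bot_iff]
  intro h hh
  -- Pairing `(T - z) u` with `u` gives `Im ⟪u, T u⟫ = Im z ‖u‖²`; the sides have opposite signs, so
  -- `u = 0`.
  obtain ⟨u, rfl⟩ := hs h
  have h1 := (Submodule.mem_orthogonal _ _).1 hh u u.2
  have h2 := congrArg Complex.im h1
  rw [inner_sub_right, Complex.sub_im, im_inner_smul_self, Complex.zero_im] at h2
  have h3 : ‖(u : X)‖ = 0 := by
    have := hT u
    by_contra hne
    have : 0 < ‖(u : X)‖ ^ 2 := by positivity
    nlinarith
  have h4 : u = 0 := Subtype.ext (norm_eq_zero.1 h3)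
  rw [h4, LinearPMap.map_zero, Submodule.coe_zero, smul_zero, sub_zero]

/-- For `y ∈ dom T*` pick `u` with `(T - i) u = (T* - i) y`; then `y - u` is orthogonal to the range
of `T + i`, which is the whole space, so `y = u ∈ dom T`. -/
theorem isSelfAdjoint_of_symmetric_of_surjective [CompleteSpace X] {T : X →ₗ.[ℂ] X}
    (hT : ∀ x y : T.domain, ⟪T x, (y : X)⟫_ℂ = ⟪(x : X), T y⟫_ℂ)
    (hs : ∀ z : ℂ, z.im ≠ 0 → ∀ x : X, ∃ u : T.domain, T u - z • (u : X) = x) :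
    IsSelfAdjoint T := by
  have hd : Dense (T.domain : Set X) :=
    dense_domain_of_surjective (z := -Complex.I) (by simp)
      (fun u => (im_inner_apply_eq_zero hT u).ge) (hs _ (by simp))
  have hle : T ≤ T.adjoint := LinearPMap.IsFormalAdjoint.le_adjoint hd hT
  refine (LinearPMap.eq_of_le_of_domain_eq hle (le_antisymm hle.1 fun y hy => ?_)).symm
  obtain ⟨u, hu⟩ := hs Complex.I (by simp) (T.adjoint ⟨y, hy⟩ - Complex.I • y)
  have hadj := LinearPMap.adjoint_isFormalAdjoint hd (T := T)
  suffices h : y - u = 0 by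
    rw [sub_eq_zero.1 h]
    exact u.2
  obtain ⟨v, hv⟩ := hs (-Complex.I) (by simp) (y - u)
  have h1 := hadj ⟨y, hy⟩ v
  have h2 := hT u v
  have h3 : ⟪y - (u : X), T v - (-Complex.I) • (v : X)⟫_ℂ = 0 := by
    rw [inner_sub_right, inner_sub_left, ← h2, ← h1, ← inner_sub_left, inner_smul_right,
      inner_sub_left y, neg_mul, sub_neg_eq_add]
    have h4 : T.adjoint ⟨y, hy⟩ - T u = Complex.I • (y - (u : X)) := by
      rw [smul_sub, sub_eq_sub_iff_sub_eq_sub]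
      exact hu.symm
    rw [h4, inner_smul_left, inner_sub_left, Complex.conj_I]
    ring
  rw [hv] at h3
  exact inner_self_eq_zero.1 h3

/-- A bounded perturbation `C` of a self-adjoint operator `Λ` such that
`c ‖y‖² ≤ |Im ⟪y, C y⟫|` is bounded below. -/
theorem perturbed_bound [CompleteSpace X] {Λ : X →ₗ.[ℂ] X} (hΛ : IsSelfAdjoint Λ) (C : X →L[ℂ] X)
    {c : ℝ} (hC : ∀ y, c * ‖y‖ ^ 2 ≤ |(⟪y, C y⟫_ℂ).im|) (φ : Λ.domain) :
    c * ‖(φ : X)‖ ≤ ‖Λ φ + C φ‖ := by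
  apply norm_bound_of_im_inner
  rw [inner_add_right, Complex.add_im,
    im_inner_apply_eq_zero (symmetric_of_isSelfAdjoint hΛ), zero_add]
  exact hC φ

/-- The lower bound and closedness of `Λ` make the range closed. If `y` is orthogonal to it,
self-adjointness of `Λ` puts `y` in `dom Λ` with `Λ y = -C* y`; hence `Im ⟪y, C y⟫ = 0` and `y = 0`.
-/
theorem perturbed_surjective [CompleteSpace X] {Λ : X →ₗ.[ℂ] X} (hΛ : IsSelfAdjoint Λ)
    (C : X →L[ℂ] X) {c : ℝ} (hc : 0 < c) (hC : ∀ y, c * ‖y‖ ^ 2 ≤ |(⟪y, C y⟫_ℂ).im|) (e : X) :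
    ∃ φ : Λ.domain, Λ φ + C φ = e := by
  let S : Λ.domain →ₗ[ℂ] X := Λ.toFun + (C : X →ₗ[ℂ] X) ∘ₗ Λ.domain.subtype
  have hS : ∀ φ, S φ = Λ φ + C φ := fun φ => rfl
  have hSb : ∀ φ : Λ.domain, c * ‖(φ : X)‖ ≤ ‖S φ‖ := perturbed_bound hΛ C hC
  suffices h : LinearMap.range S = ⊤ by
    obtain ⟨φ, hφ⟩ := LinearMap.range_eq_top.1 h e
    exact ⟨φ, hφ⟩
  have hcl : IsClosed (LinearMap.range S : Set X) := by
    refine IsSeqClosed.isClosed fun u y hu hy => ?_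
    choose φ hφ using hu
    have hcau : CauchySeq fun n => (φ n : X) := by
      rw [Metric.cauchySeq_iff']
      intro ε hε
      obtain ⟨N, hN⟩ := Metric.cauchySeq_iff'.1 hy.cauchySeq (c * ε) (by positivity)
      refine ⟨N, fun n hn => ?_⟩
      have h1 := hN n hn
      have h2 := hSb (φ n - φ N)
      rw [map_sub, hφ, hφ, Submodule.coe_sub, ← dist_eq_norm, ← dist_eq_norm] at h2
      exact lt_of_mul_lt_mul_left (h2.trans_lt h1) hc.le
    obtain ⟨ψ, hψ⟩ := cauchySeq_tendsto_of_complete hcau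
    have hΛψ : Filter.Tendsto (fun n => Λ (φ n)) Filter.atTop (nhds (y - C ψ)) := by
      have := hy.sub ((C.continuous.tendsto ψ).comp hψ)
      refine this.congr fun n => ?_
      rw [← hφ n, hS]
      simp
    have hmem : (ψ, y - C ψ) ∈ Λ.graph :=
      IsClosed.mem_of_tendsto hΛ.isClosed (hψ.prodMk_nhds hΛψ)
        (Filter.Eventually.of_forall fun n => LinearPMap.mem_graph _ _)
    obtain ⟨χ, h1, h2⟩ := (LinearPMap.mem_graph_iff _).1 hmem
    refine ⟨χ, ?_⟩
    rw [hS, h2, h1, sub_add_cancel]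
  rw [← hcl.submodule_topologicalClosure_eq, Submodule.topologicalClosure_eq_top_iff,
    Submodule.eq_bot_iff]
  intro y hy
  rw [Submodule.mem_orthogonal'] at hy
  obtain ⟨hyd, hyΛ⟩ := mem_domain_of_isSelfAdjoint hΛ (y := y)
    (w := -(ContinuousLinearMap.adjoint C y)) fun x => by
      have h1 := hy (S x) ⟨x, rfl⟩
      rw [hS, inner_add_right] at h1
      rw [inner_neg_left, ContinuousLinearMap.adjoint_inner_left]
      exact (eq_neg_of_add_eq_zero_left h1).symm
  have h1 := im_inner_apply_eq_zero (symmetric_of_isSelfAdjoint hΛ) ⟨y, hyd⟩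
  rw [hyΛ, inner_neg_right, ContinuousLinearMap.adjoint_inner_right, Complex.neg_im,
    neg_eq_zero, ← inner_conj_symm, Complex.conj_im, neg_eq_zero] at h1
  have h2 := hC y
  rw [h1, abs_zero] at h2
  have h3 : ‖y‖ ^ 2 = 0 := le_antisymm (nonpos_of_mul_nonpos_right h2 hc) (sq_nonneg _)
  exact norm_eq_zero.1 (pow_eq_zero_iff two_ne_zero |>.1 h3)

theorem mem_resSet_of_isSelfAdjoint [CompleteSpace X] {T : X →ₗ.[ℂ] X} (hT : IsSelfAdjoint T)
    {z : ℂ} (hz : z.im ≠ 0) : z ∈ resSet T := by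
  refine mem_resSet_of_symmetric (symmetric_of_isSelfAdjoint hT) hz fun x => ?_
  obtain ⟨u, hu⟩ := perturbed_surjective hT (-z • ContinuousLinearMap.id ℂ X) (abs_pos.2 hz)
    (fun y => by
      simp only [smul_apply, ContinuousLinearMap.id_apply]
      rw [im_inner_smul_self, abs_mul, Complex.neg_im, abs_neg, abs_of_nonneg (sq_nonneg ‖y‖)]) x
  refine ⟨u, ?_⟩
  rw [← hu]
  simp [sub_eq_add_neg]

theorem inner_res_of_isSelfAdjoint [CompleteSpace X] {T : X →ₗ.[ℂ] X} (hT : IsSelfAdjoint T)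
    {z : ℂ} (hz : z ∈ resSet T) (hz' : conj z ∈ resSet T) (x y : X) :
    ⟪res T z x, y⟫_ℂ = ⟪x, res T (conj z) y⟫_ℂ := by
  obtain ⟨h1, h2⟩ := (isResolventAt_res hz).1 x
  obtain ⟨h3, h4⟩ := (isResolventAt_res hz').1 y
  have h5 := symmetric_of_isSelfAdjoint hT ⟨_, h1⟩ ⟨_, h3⟩
  conv_lhs => rw [← h4]
  conv_rhs => rw [← h2]
  rw [inner_sub_right, inner_sub_left, h5, inner_smul_left, inner_smul_right]

end Operators

/-! ### Abstract boundary-value problems -/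

theorem apply_eq_of_mem_graph {Y Z : Type*} [AddCommGroup Y] [Module ℂ Y] [AddCommGroup Z]
    [Module ℂ Z] {T : Y →ₗ.[ℂ] Z} {x : Y} {y : Z} (h : (x, y) ∈ T.graph) (hx : x ∈ T.domain) :
    T ⟨x, hx⟩ = y := by
  obtain ⟨w, h1, h2⟩ := (LinearPMap.mem_graph_iff _).1 h
  obtain rfl : w = ⟨x, hx⟩ := Subtype.ext h1
  exact h2

namespace Triple

variable {H E : Type*} [NormedAddCommGroup H] [InnerProductSpace ℂ H] [CompleteSpace H]
  [NormedAddCommGroup E] [InnerProductSpace ℂ E] [CompleteSpace E] (t : Triple H E)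

theorem A_apply {u f : H} {φ : E} (h : u = t.A₀inv f + t.lift φ) (hu : u ∈ t.A.domain) :
    t.A ⟨u, hu⟩ = f :=
  apply_eq_of_mem_graph (t.mem_graph_A.2 ⟨φ, h⟩) hu

theorem Γ₀_apply {u f : H} {φ : E} (h : u = t.A₀inv f + t.lift φ) (hu : u ∈ t.Γ₀.domain) :
    t.Γ₀ ⟨u, hu⟩ = φ :=
  apply_eq_of_mem_graph (t.mem_graph_Γ₀.2 ⟨f, h⟩) hu

theorem Γ₁_apply {u f : H} {φ : t.Λ.domain} (h : u = t.A₀inv f + t.lift φ)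
    (hu : u ∈ t.Γ₁.domain) :
    t.Γ₁ ⟨u, hu⟩ = ContinuousLinearMap.adjoint t.lift f + t.Λ φ :=
  apply_eq_of_mem_graph (t.mem_graph_Γ₁.2 ⟨f, φ, h, rfl⟩) hu

theorem inner_A₀inv (f g : H) : ⟪t.A₀inv f, g⟫_ℂ = ⟪f, t.A₀inv g⟫_ℂ := by
  have h0 : conj (0 : ℂ) = 0 := map_zero _
  have := inner_res_of_isSelfAdjoint t.isSelfAdjoint_A₀ t.zero_mem_resSet
    (h0.symm ▸ t.zero_mem_resSet) f g
  rwa [h0] at this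

/-- Green's formula. -/
theorem green {u v : H} (hu : u ∈ t.Γ₁.domain) (hv : v ∈ t.Γ₁.domain) :
    ⟪t.A ⟨u, t.Γ₁_domain_le_A hu⟩, v⟫_ℂ - ⟪u, t.A ⟨v, t.Γ₁_domain_le_A hv⟩⟫_ℂ =
      ⟪t.Γ₁ ⟨u, hu⟩, t.Γ₀ ⟨v, t.Γ₁_domain_le_Γ₀ hv⟩⟫_ℂ -
        ⟪t.Γ₀ ⟨u, t.Γ₁_domain_le_Γ₀ hu⟩, t.Γ₁ ⟨v, hv⟩⟫_ℂ := by
  obtain ⟨f, φ, h⟩ := t.mem_domain_Γ₁.1 hu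
  obtain ⟨g, ψ, k⟩ := t.mem_domain_Γ₁.1 hv
  rw [t.A_apply h, t.A_apply k, t.Γ₀_apply h, t.Γ₀_apply k, t.Γ₁_apply h, t.Γ₁_apply k]
  conv_lhs => rw [h, k]
  rw [inner_add_right, inner_add_right, inner_add_left, inner_add_left,
    ContinuousLinearMap.adjoint_inner_left, ContinuousLinearMap.adjoint_inner_right,
    inner_A₀inv, symmetric_of_isSelfAdjoint t.isSelfAdjoint_Λ]
  ring

theorem A₀inv_add_smul_res {z : ℂ} (hz : z ∈ resSet t.A₀) (h : H) :
    t.A₀inv (h + z • res t.A₀ z h) = res t.A₀ z h := by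
  obtain ⟨hd, hh⟩ := (isResolventAt_res hz).1 h
  rw [← sub_eq_iff_eq_add.1 hh]
  exact t.A₀inv_A₀ ⟨_, hd⟩

theorem γ_apply (z : ℂ) (φ : E) : t.γ z φ = t.lift φ + z • res t.A₀ z (t.lift φ) := by
  simp [γ]

/-- Shows that `u = γ(z) φ` satisfies `A u = z u` and `Γ₀ u = φ`. -/
theorem γ_decomp {z : ℂ} (hz : z ∈ resSet t.A₀) (φ : E) :
    t.γ z φ = t.A₀inv (z • t.γ z φ) + t.lift φ := by
  rw [map_smul, t.γ_apply, t.A₀inv_add_smul_res hz, add_comm]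

theorem M_apply {z : ℂ} (hz : z ∈ resSet t.A₀) (φ : (t.M z).domain) :
    t.M z φ = t.Λ φ + ContinuousLinearMap.adjoint t.lift (z • t.γ z φ) := by
  rw [add_comm]
  exact t.Γ₁_apply (t.γ_decomp hz φ) (t.γ_mem z φ)

theorem adjoint_γ_apply {z : ℂ} (hz : z ∈ resSet t.A₀) (hz' : conj z ∈ resSet t.A₀) (h : H) :
    ContinuousLinearMap.adjoint (t.γ (conj z)) h =
      ContinuousLinearMap.adjoint t.lift (h + z • res t.A₀ z h) := by
  refine ext_inner_right ℂ fun φ => ?_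
  rw [ContinuousLinearMap.adjoint_inner_left, ContinuousLinearMap.adjoint_inner_left, γ_apply,
    inner_add_right, inner_add_left, inner_smul_right, inner_smul_left,
    inner_res_of_isSelfAdjoint t.isSelfAdjoint_A₀ hz hz']

/-- Write `Π y = γ(z) y - A₀⁻¹ (z γ(z) y)`; the quadratic form of `A₀⁻¹` is real and drops out. This
is the Nevanlinna property of `M`. -/
theorem im_inner_adjoint_lift_γ {z : ℂ} (hz : z ∈ resSet t.A₀) (y : E) :
    (⟪y, ContinuousLinearMap.adjoint t.lift (z • t.γ z y)⟫_ℂ).im = z.im * ‖t.γ z y‖ ^ 2 := by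
  have h1 : t.lift y = t.γ z y - t.A₀inv (z • t.γ z y) :=
    eq_sub_of_add_eq' (t.γ_decomp hz y).symm
  have h2 : (⟪t.A₀inv (z • t.γ z y), z • t.γ z y⟫_ℂ).im = 0 := by
    rw [← Complex.conj_eq_iff_im, inner_conj_symm, inner_A₀inv]
  rw [ContinuousLinearMap.adjoint_inner_right, h1, inner_sub_left, Complex.sub_im, h2, sub_zero,
    im_inner_smul_self]

/-- The bounded operator `M(z) - σ - Λ`. -/
def Mrem (z σ : ℂ) : E →L[ℂ] E :=
  ContinuousLinearMap.adjoint t.lift ∘L (z • t.γ z) - σ • ContinuousLinearMap.id ℂ E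

theorem Mrem_apply (z σ : ℂ) (y : E) :
    t.Mrem z σ y = ContinuousLinearMap.adjoint t.lift (z • t.γ z y) - σ • y := by
  simp [Mrem]

theorem M_sub_smul {z : ℂ} (hz : z ∈ resSet t.A₀) (σ : ℂ) (φ : (t.M z).domain) :
    t.M z φ - σ • (φ : E) = t.Λ φ + t.Mrem z σ φ := by
  rw [t.M_apply hz, Mrem_apply, add_sub_assoc]

/-- The imaginary part is `Im z ‖γ(z) y‖² - Im σ ‖y‖²`, whose terms have the same sign, so the first
can be discarded. -/
theorem Mrem_bound {z σ : ℂ} (hz : z ∈ resSet t.A₀) (hσ : z.im * σ.im < 0) (y : E) :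
    |σ.im| * ‖y‖ ^ 2 ≤ |(⟪y, t.Mrem z σ y⟫_ℂ).im| := by
  rw [Mrem_apply, inner_sub_right, Complex.sub_im, t.im_inner_adjoint_lift_γ hz,
    im_inner_smul_self]
  rcases mul_neg_iff.1 hσ with ⟨h1, h2⟩ | ⟨h1, h2⟩
  · rw [abs_of_neg h2]
    refine le_trans ?_ (le_abs_self _)
    nlinarith [mul_nonneg h1.le (sq_nonneg ‖t.γ z y‖)]
  · rw [abs_of_pos h2]
    refine le_trans ?_ (neg_le_abs _)
    nlinarith [mul_nonneg (neg_nonneg.2 h1.le) (sq_nonneg ‖t.γ z y‖)]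

theorem mem_resSet_M {z σ : ℂ} (hz : z ∈ resSet t.A₀) (hσ : z.im * σ.im < 0) :
    σ ∈ resSet (t.M z) := by
  have hσ' : 0 < |σ.im| := abs_pos.2 (right_ne_zero_of_mul hσ.ne)
  refine mem_resSet_of_bound hσ' (fun u => ?_) fun x => ?_
  · rw [t.M_sub_smul hz]
    exact perturbed_bound t.isSelfAdjoint_Λ _ (t.Mrem_bound hz hσ) u
  · obtain ⟨φ, hφ⟩ :=
      perturbed_surjective t.isSelfAdjoint_Λ _ hσ' (t.Mrem_bound hz hσ) x
    exact ⟨φ, (t.M_sub_smul hz σ φ).trans hφ⟩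

theorem res_sub_γ_decomp {z : ℂ} (hz : z ∈ resSet t.A₀) (h : H) (ψ : E) :
    res t.A₀ z h - t.γ z ψ =
      t.A₀inv (h + z • (res t.A₀ z h - t.γ z ψ)) + t.lift (-ψ) := by
  conv_lhs => rw [← t.A₀inv_add_smul_res hz h, t.γ_decomp hz]
  simp only [map_add, map_sub, map_smul, map_neg, smul_sub]
  abel

/-- The vector `(A₀ - z)⁻¹ h + γ(z) (M(z) - σ)⁻¹ (e - γ(z̄)* h)` solves the boundary-value problem
`(A - z) u = h`, `Γ₁ u - σ Γ₀ u = e`. -/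
theorem solution {z σ : ℂ} (hz : z ∈ resSet t.A₀) (hz' : conj z ∈ resSet t.A₀)
    (hσ : σ ∈ resSet (t.M z)) (h : H) (e : E) {u : H}
    (hu : u = res t.A₀ z h -
      t.γ z (res (t.M z) σ (ContinuousLinearMap.adjoint (t.γ (conj z)) h - e))) :
    ∃ hd : u ∈ t.Γ₁.domain, t.A ⟨u, t.Γ₁_domain_le_A hd⟩ - z • u = h ∧
      t.Γ₁ ⟨u, hd⟩ - σ • t.Γ₀ ⟨u, t.Γ₁_domain_le_Γ₀ hd⟩ = e := by
  obtain ⟨ψ, hψ, hM, hu⟩ : ∃ (ψ : E) (hψ : ψ ∈ t.Λ.domain),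
      t.Λ ⟨ψ, hψ⟩ + ContinuousLinearMap.adjoint t.lift (z • t.γ z ψ) - σ • ψ =
        ContinuousLinearMap.adjoint t.lift (h + z • res t.A₀ z h) - e ∧
      u = res t.A₀ z h - t.γ z ψ := by
    obtain ⟨hψ, hM⟩ :=
      (isResolventAt_res hσ).1 (ContinuousLinearMap.adjoint (t.γ (conj z)) h - e)
    refine ⟨_, hψ, ?_, hu⟩
    rw [← t.adjoint_γ_apply hz hz']
    exact (congrArg (· - _) (t.M_apply hz _).symm).trans hM
  -- The `Π`-component of `u = (A₀ - z)⁻¹ h - γ(z) ψ` is `-ψ`, so `Γ₀ u = -ψ`.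
  let φ : t.Λ.domain := -⟨ψ, hψ⟩
  have hφ : t.Λ φ = -t.Λ ⟨ψ, hψ⟩ := LinearPMap.map_neg _ _
  have hdec : u = t.A₀inv (h + z • u) + t.lift (φ : E) := by
    rw [hu]
    exact t.res_sub_γ_decomp hz h ψ
  have hd : u ∈ t.Γ₁.domain := t.mem_domain_Γ₁.2 ⟨_, φ, hdec⟩
  refine ⟨hd, ?_, ?_⟩
  · rw [t.A_apply hdec, add_sub_cancel_right]
  · rw [t.Γ₁_apply hdec, t.Γ₀_apply hdec, hφ]
    have h2 : (φ : E) = -ψ := rfl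
    rw [h2, hu, smul_sub, ← add_sub_assoc, map_sub, ← sub_eq_zero]
    rw [← sub_eq_zero] at hM
    rw [← neg_eq_zero, ← hM]
    simp only [smul_neg]
    abel

theorem exists_solution {z σ : ℂ} (hσ : z.im * σ.im < 0) (h : H) (e : E) :
    ∃ (u : H) (hd : u ∈ t.Γ₁.domain), t.A ⟨u, t.Γ₁_domain_le_A hd⟩ - z • u = h ∧
      t.Γ₁ ⟨u, hd⟩ - σ • t.Γ₀ ⟨u, t.Γ₁_domain_le_Γ₀ hd⟩ = e := by
  have h1 : z.im ≠ 0 := left_ne_zero_of_mul hσ.ne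
  have hz : z ∈ resSet t.A₀ := mem_resSet_of_isSelfAdjoint t.isSelfAdjoint_A₀ h1
  have hz' : conj z ∈ resSet t.A₀ :=
    mem_resSet_of_isSelfAdjoint t.isSelfAdjoint_A₀ (by simpa using h1)
  exact ⟨_, t.solution hz hz' (t.mem_resSet_M hz hσ) h e rfl⟩

/-! ### Maximal dissipativity and the resolvent of `L` -/

theorem L_apply {u : H} (hu : u ∈ t.L.domain) (hA : u ∈ t.A.domain) :
    t.L ⟨u, hu⟩ = t.A ⟨u, hA⟩ := rfl

/-- Green's formula with `v = u` and `Γ₁ u = i Γ₀ u` shows that the imaginary part equals `‖Γ₀ u‖²`.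
-/
theorem im_inner_L (u : t.L.domain) : 0 ≤ (⟪(u : H), t.L u⟫_ℂ).im := by
  obtain ⟨u, hu⟩ := u
  obtain ⟨hd, h⟩ := t.mem_domain_L.1 hu
  have hA := t.Γ₁_domain_le_A hd
  have h1 := t.green hd hd
  rw [sub_eq_zero.1 h, inner_smul_left, inner_smul_right, Complex.conj_I,
    ← inner_conj_symm, inner_self_eq_norm_sq_to_K] at h1
  have h2 := congrArg Complex.im h1
  simp only [Complex.sub_im, Complex.conj_im] at h2
  rw [t.L_apply hu hA]
  have h3 : (-Complex.I * (‖t.Γ₀ ⟨u, t.Γ₁_domain_le_Γ₀ hd⟩‖ : ℂ) ^ 2).im =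
      -‖t.Γ₀ ⟨u, t.Γ₁_domain_le_Γ₀ hd⟩‖ ^ 2 := by simp [← Complex.ofReal_pow]
  have h4 : (Complex.I * (‖t.Γ₀ ⟨u, t.Γ₁_domain_le_Γ₀ hd⟩‖ : ℂ) ^ 2).im =
      ‖t.Γ₀ ⟨u, t.Γ₁_domain_le_Γ₀ hd⟩‖ ^ 2 := by simp [← Complex.ofReal_pow]
  erw [h3, h4] at h2
  nlinarith [sq_nonneg ‖t.Γ₀ ⟨u, t.Γ₁_domain_le_Γ₀ hd⟩‖]

theorem L_surjective {z : ℂ} (hz : z.im < 0) (h : H) :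
    ∃ u : t.L.domain, t.L u - z • (u : H) = h := by
  obtain ⟨u, hd, h1, h2⟩ := t.exists_solution (z := z) (σ := Complex.I) (by simpa) h 0
  exact ⟨⟨u, t.mem_domain_L.2 ⟨hd, h2⟩⟩, h1⟩

theorem mem_resSet_L {z : ℂ} (hz : z.im < 0) : z ∈ resSet t.L := by
  refine mem_resSet_of_bound (neg_pos.2 hz) (fun u => norm_bound_of_im_inner ?_)
    (t.L_surjective hz)
  rw [inner_sub_right, Complex.sub_im, im_inner_smul_self]
  refine le_trans ?_ (le_abs_self _)
  linarith [t.im_inner_L u]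

theorem isMaximalDissipative_L : IsMaximalDissipative t.L :=
  ⟨dense_domain_of_surjective (z := -Complex.I) (by simp) t.im_inner_L (t.L_surjective (by simp)),
    t.im_inner_L, fun _ hz => t.mem_resSet_L hz⟩

theorem res_L_eq_of_solution {z : ℂ} (hz : z.im < 0) {u h : H} (hd : u ∈ t.Γ₁.domain)
    (h1 : t.A ⟨u, t.Γ₁_domain_le_A hd⟩ - z • u = h)
    (h2 : t.Γ₁ ⟨u, hd⟩ - Complex.I • t.Γ₀ ⟨u, t.Γ₁_domain_le_Γ₀ hd⟩ = 0) :
    res t.L z h = u := by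
  have h3 := (isResolventAt_res (t.mem_resSet_L hz)).2 ⟨u, t.mem_domain_L.2 ⟨hd, h2⟩⟩
  rw [t.L_apply _ (t.Γ₁_domain_le_A hd), h1] at h3
  exact h3

/-- Krein's resolvent formula. -/
theorem res_L_eq {z : ℂ} (hz : z.im < 0) : z ∈ resSet t.A₀ ∧ Complex.I ∈ resSet (t.M z) ∧
    res t.L z = res t.A₀ z - t.γ z ∘L res (t.M z) Complex.I ∘L
      ContinuousLinearMap.adjoint (t.γ (starRingEnd ℂ z)) := by
  have hA : z ∈ resSet t.A₀ := mem_resSet_of_isSelfAdjoint t.isSelfAdjoint_A₀ hz.ne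
  have hA' : conj z ∈ resSet t.A₀ :=
    mem_resSet_of_isSelfAdjoint t.isSelfAdjoint_A₀ (by simpa using hz.ne)
  have hM : Complex.I ∈ resSet (t.M z) := t.mem_resSet_M hA (by simpa)
  refine ⟨hA, hM, ContinuousLinearMap.ext fun h => ?_⟩
  obtain ⟨hd, h1, h2⟩ := t.solution hA hA' hM h 0 rfl
  rw [t.res_L_eq_of_solution hz hd h1 h2, sub_zero]
  rfl

end Triple

/-! ### Locally absolutely continuous vector-valued functions -/

section Primitive

variable {E F G : Type*} [NormedAddCommGroup E] [NormedSpace ℝ E]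
  [NormedAddCommGroup F] [NormedSpace ℝ F] [NormedAddCommGroup G] [NormedSpace ℝ G]

/-- `U` is locally absolutely continuous and the locally integrable function `u` is its
derivative. -/
def IsPrimitive (U u : ℝ → E) : Prop :=
  (∀ a b, IntervalIntegrable u volume a b) ∧ ∀ a b, U b - U a = ∫ x in a..b, u x

theorem IsPrimitive.eq_add {U u : ℝ → E} (h : IsPrimitive U u) (a x : ℝ) :
    U x = U a + ∫ s in a..x, u s := by rw [← h.2, add_sub_cancel]

theorem IsPrimitive.continuous {U u : ℝ → E} (h : IsPrimitive U u) : Continuous U := by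
  have : U = fun x => U 0 + ∫ s in (0 : ℝ)..x, u s := funext fun x => h.eq_add 0 x
  rw [this]
  exact continuous_const.add (intervalIntegral.continuous_primitive h.1 0)

theorem isPrimitive_of_hasDerivAt [CompleteSpace E] {U u : ℝ → E}
    (h : ∀ x, HasDerivAt U (u x) x) (hu : Continuous u) : IsPrimitive U u :=
  ⟨fun a b => hu.intervalIntegrable a b, fun a b =>
    (intervalIntegral.integral_eq_sub_of_hasDerivAt (fun x _ => h x)
      (hu.intervalIntegrable a b)).symm⟩

theorem isPrimitive_integral {u : ℝ → E} (hu : LocallyIntegrable u) (c : E) :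
    IsPrimitive (fun x => c + ∫ s in (0 : ℝ)..x, u s) u := by
  have hi : ∀ a b, IntervalIntegrable u volume a b := fun a b =>
    (intervalIntegrable_iff).2 ((hu.integrableOn_isCompact isCompact_uIcc).mono_set
      uIoc_subset_uIcc)
  refine ⟨hi, fun a b => ?_⟩
  rw [add_sub_add_left_eq_sub, intervalIntegral.integral_interval_sub_left (hi _ _) (hi _ _)]

theorem integrableOn_bilin (B : E →L[ℝ] F →L[ℝ] G) {f : ℝ → E} {g : ℝ → F} {a b : ℝ}
    (hf : IntegrableOn f (Ioc a b)) (hg : Continuous g) :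
    IntegrableOn (fun x => B (f x) (g x)) (Ioc a b) := by
  obtain ⟨C, hC⟩ := isCompact_Icc (a := a) (b := b).exists_bound_of_continuousOn hg.continuousOn
  refine Integrable.mono' (hf.norm.mul_const (‖B‖ * C))
    (B.aestronglyMeasurable_comp₂ hf.aestronglyMeasurable hg.aestronglyMeasurable) ?_
  filter_upwards [ae_restrict_mem measurableSet_Ioc] with x hx
  calc ‖B (f x) (g x)‖ ≤ ‖B‖ * ‖f x‖ * ‖g x‖ := B.le_opNorm₂ _ _
    _ ≤ ‖B‖ * ‖f x‖ * C := by gcongr; exact hC x (Ioc_subset_Icc_self hx)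
    _ = ‖f x‖ * (‖B‖ * C) := by ring

/-- The right side is the integral of `B (f x) (g y)` over the square `(a, b]²`. The diagonal cuts
the square into two triangles, and Fubini turns their integrals into the two terms on the left. -/
theorem setIntegral_bilin_primitives [CompleteSpace E] [CompleteSpace F] [CompleteSpace G]
    (B : E →L[ℝ] F →L[ℝ] G) {f : ℝ → E} {g : ℝ → F} {a b : ℝ}
    (hf : IntegrableOn f (Ioc a b)) (hg : IntegrableOn g (Ioc a b)) :
    (∫ x in Ioc a b, B (f x) (∫ s in Ioc a x, g s)) +
      ∫ x in Ioc a b, B (∫ s in Ioc a x, f s) (g x) =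
      B (∫ x in Ioc a b, f x) (∫ x in Ioc a b, g x) := by
  set μ : Measure ℝ := volume.restrict (Ioc a b) with hμ
  let h : ℝ × ℝ → G := fun p => B (f p.1) (g p.2)
  have hh : Integrable h (μ.prod μ) :=
    Integrable.op_fst_snd (op := fun x y => B x y) (by fun_prop) ⟨‖B‖, B.le_opNorm₂⟩ hf hg
  let S : Set (ℝ × ℝ) := {p | p.1 ≤ p.2}
  have hS : MeasurableSet S := measurableSet_le measurable_fst measurable_snd
  have e1 : ∫ p, h p ∂(μ.prod μ) = B (∫ x in Ioc a b, f x) (∫ x in Ioc a b, g x) := by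
    rw [integral_prod _ hh]
    have : ∀ x, ∫ y, h (x, y) ∂μ = B.flip (∫ y, g y ∂μ) (f x) := fun x =>
      (B (f x)).integral_comp_comm hg
    simp_rw [this]
    exact (B.flip _).integral_comp_comm hf
  have e2 : ∫ p, S.indicator h p ∂(μ.prod μ) =
      ∫ x in Ioc a b, B (∫ s in Ioc a x, f s) (g x) := by
    rw [integral_prod_symm _ (hh.indicator hS)]
    refine integral_congr_ae ?_
    filter_upwards [ae_restrict_mem measurableSet_Ioc] with x hx
    have : ∀ y, S.indicator h (y, x) = (Iic x).indicator (fun y => B.flip (g x) (f y)) y := by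
      intro y
      by_cases hy : y ≤ x
      · rw [indicator_of_mem (show (y, x) ∈ S from hy), indicator_of_mem (show y ∈ Iic x from hy)]
        rfl
      · rw [indicator_of_notMem (show (y, x) ∉ S from hy),
          indicator_of_notMem (show y ∉ Iic x from hy)]
    simp_rw [this]
    rw [integral_indicator measurableSet_Iic, hμ, Measure.restrict_restrict measurableSet_Iic,
      inter_comm, Ioc_inter_Iic, min_eq_right hx.2]
    exact (B.flip (g x)).integral_comp_comm (hf.mono_set (Ioc_subset_Ioc_right hx.2))
  have e3 : ∫ p, Sᶜ.indicator h p ∂(μ.prod μ) =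
      ∫ x in Ioc a b, B (f x) (∫ s in Ioc a x, g s) := by
    rw [integral_prod _ (hh.indicator hS.compl)]
    refine integral_congr_ae ?_
    filter_upwards [ae_restrict_mem measurableSet_Ioc] with x hx
    have : ∀ y, Sᶜ.indicator h (x, y) = (Iio x).indicator (fun y => B (f x) (g y)) y := by
      intro y
      by_cases hy : y < x
      · rw [indicator_of_mem (show (x, y) ∈ Sᶜ from not_le.2 hy),
          indicator_of_mem (show y ∈ Iio x from hy)]
      · rw [indicator_of_notMem (show (x, y) ∉ Sᶜ from fun h => h (not_lt.1 hy)),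
          indicator_of_notMem (show y ∉ Iio x from hy)]
    simp_rw [this]
    -- The complement of `S` is the strict triangle, so the slice misses the endpoint `x`, a null
    -- set.
    have hI : Iio x ∩ Ioc a b = Ioo a x := by
      ext y
      simp only [mem_inter_iff, mem_Iio, mem_Ioc, mem_Ioo]
      exact ⟨fun h => ⟨h.2.1, h.1⟩, fun h => ⟨h.2, h.1, h.2.le.trans hx.2⟩⟩
    rw [integral_indicator measurableSet_Iio, hμ, Measure.restrict_restrict measurableSet_Iio, hI,
      ← integral_Ioc_eq_integral_Ioo]
    exact (B (f x)).integral_comp_comm (hg.mono_set (Ioc_subset_Ioc_right hx.2))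
  rw [← e1, ← e2, ← e3, add_comm, ← integral_add (hh.indicator hS) (hh.indicator hS.compl)]
  simp_rw [indicator_self_add_compl_apply]

/-- The product rule. -/
theorem IsPrimitive.bilin [CompleteSpace E] [CompleteSpace F] [CompleteSpace G]
    (B : E →L[ℝ] F →L[ℝ] G) {U u : ℝ → E} {V v : ℝ → F} (hU : IsPrimitive U u)
    (hV : IsPrimitive V v) :
    IsPrimitive (fun x => B (U x) (V x)) (fun x => B (u x) (V x) + B (U x) (v x)) := by
  have i1 : ∀ a b, IntegrableOn (fun x => B (u x) (V x)) (Ioc a b) := fun a b =>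
    integrableOn_bilin B (hU.1 a b).1 hV.continuous
  have i2 : ∀ a b, IntegrableOn (fun x => B (U x) (v x)) (Ioc a b) := fun a b =>
    integrableOn_bilin B.flip (hV.1 a b).1 hU.continuous
  -- As `u` and `v` are only locally integrable, the product is not differentiated pointwise: the
  -- constants `U a`, `V a` are split off, and the Fubini identity treats the remaining increments.
  have key : ∀ a b, a ≤ b → B (U b) (V b) - B (U a) (V a) =
      ∫ x in a..b, (B (u x) (V x) + B (U x) (v x)) := by
    intro a b hab
    have hu := (hU.1 a b).1
    have hv := (hV.1 a b).1
    have cU : Continuous fun x => U x - U a := hU.continuous.sub continuous_const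
    have cV : Continuous fun x => V x - V a := hV.continuous.sub continuous_const
    have h1 : ∫ x in Ioc a b, B (u x) (V x) =
        B (∫ x in Ioc a b, u x) (V a) + ∫ x in Ioc a b, B (u x) (∫ s in Ioc a x, v s) := by
      have h3 : B (∫ x in Ioc a b, u x) (V a) = ∫ x in Ioc a b, B (u x) (V a) :=
        ((B.flip (V a)).integral_comp_comm hu).symm
      rw [h3, show ∫ x in Ioc a b, B (u x) (∫ s in Ioc a x, v s) =
        ∫ x in Ioc a b, B (u x) (V x - V a) from setIntegral_congr_fun measurableSet_Ioc
          fun x hx => by rw [hV.2, intervalIntegral.integral_of_le hx.1.le],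
        ← integral_add (integrableOn_bilin B hu continuous_const) (integrableOn_bilin B hu cV)]
      simp
    have h2 : ∫ x in Ioc a b, B (U x) (v x) =
        B (U a) (∫ x in Ioc a b, v x) + ∫ x in Ioc a b, B (∫ s in Ioc a x, u s) (v x) := by
      have h3 : B (U a) (∫ x in Ioc a b, v x) = ∫ x in Ioc a b, B (U a) (v x) :=
        ((B (U a)).integral_comp_comm hv).symm
      rw [h3, show ∫ x in Ioc a b, B (∫ s in Ioc a x, u s) (v x) =
        ∫ x in Ioc a b, B (U x - U a) (v x) from setIntegral_congr_fun measurableSet_Ioc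
          fun x hx => by rw [hU.2, intervalIntegral.integral_of_le hx.1.le],
        ← integral_add (f := fun x => B (U a) (v x)) (g := fun x => B (U x - U a) (v x))
          (integrableOn_bilin B.flip hv continuous_const) (integrableOn_bilin B.flip hv cU)]
      simp
    rw [intervalIntegral.integral_of_le hab, integral_add (i1 a b) (i2 a b), h1, h2,
      hU.eq_add a b, hV.eq_add a b, intervalIntegral.integral_of_le hab,
      intervalIntegral.integral_of_le hab]
    have h3 := setIntegral_bilin_primitives B hu hv
    simp only [map_add, add_apply]
    rw [← h3]
    abel
  refine ⟨fun a b => ⟨(i1 a b).add (i2 a b), (i1 b a).add (i2 b a)⟩, fun a b => ?_⟩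
  rcases le_total a b with hab | hab
  · exact key a b hab
  · rw [intervalIntegral.integral_symm, ← key b a hab, neg_sub]

theorem IsPrimitive.integral_eq_zero {U u : ℝ → E} (h : IsPrimitive U u) {R : ℝ}
    (hR : 0 ≤ R) (hU : ∀ x, R ≤ |x| → U x = 0) (hu : ∀ x, R ≤ |x| → u x = 0) :
    ∫ x, u x = 0 := by
  have h1 := h.2 (-R) R
  rw [hU R (le_abs_self R), hU (-R) (by rw [abs_neg]; exact le_abs_self R), sub_zero,
    intervalIntegral.integral_of_le (by linarith)] at h1
  rw [h1]
  refine (setIntegral_eq_integral_of_forall_compl_eq_zero fun x hx => hu x ?_).symm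
  by_contra hlt
  exact hx ⟨(abs_lt.1 (not_le.1 hlt)).1, (abs_lt.1 (not_le.1 hlt)).2.le⟩

end Primitive

/-! ### The du Bois-Reymond lemma -/

section DuBoisReymond

variable {E : Type*} [NormedAddCommGroup E] [NormedSpace ℝ E] [CompleteSpace E]

/-- The zero mean is what makes the primitive based at `a` vanish beyond `b`. -/
theorem exists_test_primitive {θ : ℝ → ℝ} (hθ : ContDiff ℝ ∞ θ) {a b : ℝ}
    (hs : Function.support θ ⊆ Icc a b) (h0 : ∫ x, θ x = 0) :
    ∃ Φ : ℝ → ℝ, ContDiff ℝ ∞ Φ ∧ tsupport Φ ⊆ Icc a b ∧ deriv Φ = θ := by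
  have hd : ∀ x, HasDerivAt (fun x => ∫ s in a..x, θ s) (θ x) x := fun x =>
    intervalIntegral.integral_hasDerivAt_right (hθ.continuous.intervalIntegrable _ _)
      hθ.continuous.stronglyMeasurable.stronglyMeasurableAtFilter hθ.continuous.continuousAt
  have hd' : deriv (fun x => ∫ s in a..x, θ s) = θ := funext fun x => (hd x).deriv
  refine ⟨fun x => ∫ s in a..x, θ s, ?_, ?_, hd'⟩
  · rw [contDiff_infty_iff_deriv, hd']
    exact ⟨fun x => (hd x).differentiableAt, hθ⟩
  · refine closure_minimal (fun x hx => ?_) isClosed_Icc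
    by_contra hx'
    apply hx
    have hz : ∀ y, y ∉ Icc a b → θ y = 0 := fun y hy => by
      by_contra h
      exact hy (hs h)
    rcases lt_or_ge x a with h | h
    · change ∫ s in a..x, θ s = 0
      rw [intervalIntegral.integral_symm, intervalIntegral.integral_of_le h.le,
        integral_Ioc_eq_integral_Ioo, setIntegral_eq_zero_of_forall_eq_zero, neg_zero]
      exact fun y hy => hz y fun hy' => (hy.2.trans_le hy'.1).false
    · have hbx : b < x := by
        by_contra hle
        exact hx' ⟨h, not_lt.1 hle⟩
      change ∫ s in a..x, θ s = 0
      rw [intervalIntegral.integral_of_le h, ← integral_Icc_eq_integral_Ioc,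
        setIntegral_eq_integral_of_forall_compl_eq_zero, h0]
      exact fun y hy => hz y fun hy' => hy ⟨hy'.1, hy'.2.trans hbx.le⟩

/-- Fix a bump `η` with integral one. For a test function `ψ`, the function `ψ - (∫ ψ) η` has mean
zero and so is the derivative of a test function; this gives `∫ ψ (u - c) = 0` with `c = ∫ η u`. -/
theorem ae_eq_const_of_integral_deriv_smul_eq_zero {I : Set ℝ} (hI : IsOpen I)
    (hc : OrdConnected I) (hne : I.Nonempty) {u : ℝ → E}
    (hu : LocallyIntegrable u (volume.restrict I))
    (h : ∀ φ : ℝ → ℝ, ContDiff ℝ ∞ φ → HasCompactSupport φ → tsupport φ ⊆ I →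
      ∫ x in I, deriv φ x • u x = 0) :
    ∃ c : E, ∀ᵐ x ∂volume.restrict I, u x = c := by
  obtain ⟨x₀, hx₀⟩ := hne
  obtain ⟨ε, hε, hball⟩ := Metric.isOpen_iff.1 hI x₀ hx₀
  let β : ContDiffBump x₀ := ⟨ε / 4, ε / 2, by positivity, by linarith⟩
  let η : ℝ → ℝ := β.normed volume
  have hη : ContDiff ℝ ∞ η := β.contDiff_normed
  have hηc : HasCompactSupport η := β.hasCompactSupport_normed
  have hη1 : ∫ x, η x = 1 := β.integral_normed
  have hηs : tsupport η ⊆ I := by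
    rw [β.tsupport_normed_eq]
    exact (Metric.closedBall_subset_ball (by change ε / 2 < ε; linarith)).trans hball
  have hηne : (tsupport η).Nonempty := by
    rw [β.tsupport_normed_eq]
    exact ⟨x₀, Metric.mem_closedBall_self (by change 0 ≤ ε / 2; positivity)⟩
  have ci : ∀ φ : ℝ → ℝ, ContDiff ℝ ∞ φ → HasCompactSupport φ → ∀ w : ℝ → E,
      LocallyIntegrable w (volume.restrict I) →
      Integrable (fun x => φ x • w x) (volume.restrict I) := fun φ h1 h2 w hw =>
    hw.integrable_smul_left_of_hasCompactSupport h1.continuous h2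
  refine ⟨∫ x in I, η x • u x, ?_⟩
  set c := ∫ x in I, η x • u x with hcdef
  have key : ∀ᵐ x ∂volume.restrict I, x ∈ I → u x - c = 0 := by
    have hlc : LocallyIntegrable (fun _ : ℝ => c) (volume.restrict I) := locallyIntegrable_const c
    refine hI.ae_eq_zero_of_integral_contDiff_smul_eq_zero
      ((hu.sub hlc).locallyIntegrableOn I) ?_
    intro ψ hψ hψc hψs
    set m := ∫ x, ψ x with hm
    have hint : ∀ φ : ℝ → ℝ, ContDiff ℝ ∞ φ → HasCompactSupport φ → Integrable φ :=
      fun φ h1 h2 => h1.continuous.integrable_of_hasCompactSupport h2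
    have hK : IsCompact (tsupport ψ ∪ tsupport η) := hψc.isCompact.union hηc.isCompact
    have hKne : (tsupport ψ ∪ tsupport η).Nonempty := hηne.mono subset_union_right
    have hKI : tsupport ψ ∪ tsupport η ⊆ I := union_subset hψs hηs
    have hθ : ContDiff ℝ ∞ (fun x => ψ x - m * η x) := hψ.sub (contDiff_const.mul hη)
    -- By compactness the infimum and supremum of the supports are attained, hence lie in `I`;
    -- order-connectedness keeps the interval between them in `I`.
    obtain ⟨Φ, hΦ, hΦs, hΦd⟩ := exists_test_primitive hθ
      (a := sInf (tsupport ψ ∪ tsupport η)) (b := sSup (tsupport ψ ∪ tsupport η)) (by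
        intro x hx
        have hx' : x ∈ tsupport ψ ∪ tsupport η := by
          by_contra hx'
          rw [mem_union, not_or] at hx'
          exact hx (by simp [image_eq_zero_of_notMem_tsupport hx'.1,
            image_eq_zero_of_notMem_tsupport hx'.2])
        exact ⟨csInf_le hK.bddBelow hx', le_csSup hK.bddAbove hx'⟩) (by
        rw [integral_sub (hint ψ hψ hψc) ((hint η hη hηc).const_mul m), integral_const_mul, hη1,
          mul_one, sub_self])
    have hΦI : tsupport Φ ⊆ I := hΦs.trans
      (hc.out (hKI (hK.sInf_mem hKne)) (hKI (hK.sSup_mem hKne)))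
    have h1 := h Φ hΦ (isCompact_Icc.of_isClosed_subset (isClosed_tsupport _) hΦs) hΦI
    rw [hΦd] at h1
    simp_rw [sub_smul, mul_smul] at h1
    rw [integral_sub (ci ψ hψ hψc u hu) ((ci η hη hηc u hu).fun_smul m), integral_smul,
      ← hcdef] at h1
    simp_rw [smul_sub]
    rw [integral_sub (ci ψ hψ hψc u hu) (ci ψ hψ hψc _ hlc), integral_smul_const,
      setIntegral_eq_integral_of_forall_compl_eq_zero
        (fun x hx => image_eq_zero_of_notMem_tsupport fun h => hx (hψs h))]
    exact h1
  filter_upwards [key, ae_restrict_mem hI.measurableSet] with x hx hxI using sub_eq_zero.1 (hx hxI)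

end DuBoisReymond

/-! ### Sobolev functions on an interval -/

section SobolevInterval

variable {E : Type*} [NormedAddCommGroup E] [InnerProductSpace ℂ E] [CompleteSpace E]

theorem memLp_indicator {I : Set ℝ} (hI : MeasurableSet I) (w : L2 E I) :
    MemLp (I.indicator w) 2 volume :=
  (memLp_indicator_iff_restrict hI).2 (Lp.memLp w)

theorem setIntegral_test_smul {I : Set ℝ} {ψ : ℝ → ℝ} (hψ : tsupport ψ ⊆ I) (u : ℝ → E) :
    ∫ x in I, ψ x • u x = ∫ x, ψ x • u x :=
  setIntegral_eq_integral_of_forall_compl_eq_zero fun x hx => by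
    rw [image_eq_zero_of_notMem_tsupport fun h => hx (hψ h), zero_smul]

theorem exists_abs_bound_of_hasCompactSupport {φ : ℝ → ℝ} (hc : HasCompactSupport φ) :
    ∃ R : ℝ, 0 ≤ R ∧ ∀ x, R ≤ |x| → x ∉ tsupport φ := by
  obtain ⟨R, hR⟩ := hc.isBounded.exists_norm_le
  refine ⟨|R| + 1, by positivity, fun x hx h => ?_⟩
  have h1 := hR x h
  rw [Real.norm_eq_abs] at h1
  linarith [le_abs_self R]

theorem integral_deriv_smul_primitive {I : Set ℝ} {G g : ℝ → E} (hG : IsPrimitive G g)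
    {φ : ℝ → ℝ} (hφ : ContDiff ℝ ∞ φ) (hc : HasCompactSupport φ) (hs : tsupport φ ⊆ I) :
    ∫ x in I, deriv φ x • G x = -∫ x in I, φ x • g x := by
  have hd : Continuous (deriv φ) := hφ.continuous_deriv (by simp)
  have hlg : LocallyIntegrable g volume := fun x =>
    ⟨Ioc (x - 1) (x + 1), Ioc_mem_nhds (by linarith) (by linarith), (hG.1 (x - 1) (x + 1)).1⟩
  have hds : tsupport (deriv φ) ⊆ tsupport φ :=
    closure_minimal support_deriv_subset (isClosed_tsupport φ)
  rw [setIntegral_test_smul hs, setIntegral_test_smul (hds.trans hs), eq_neg_iff_add_eq_zero,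
    ← integral_add (hG.continuous.locallyIntegrable.integrable_smul_left_of_hasCompactSupport
      hd hc.deriv) (hlg.integrable_smul_left_of_hasCompactSupport hφ.continuous hc)]
  have hP : IsPrimitive φ (deriv φ) := isPrimitive_of_hasDerivAt
    (fun x => ((hφ.differentiable (by simp)) x).hasDerivAt) hd
  obtain ⟨R, hR0, hR⟩ := exists_abs_bound_of_hasCompactSupport hc
  refine (hP.bilin (ContinuousLinearMap.lsmul ℝ ℝ) hG).integral_eq_zero hR0
    (fun x hx => ?_) fun x hx => ?_
  · simp [image_eq_zero_of_notMem_tsupport (hR x hx)]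
  · simp [image_eq_zero_of_notMem_tsupport (hR x hx),
      image_eq_zero_of_notMem_tsupport fun h => hR x hx (hds h)]

theorem hasWeakDeriv_of_isPrimitive {I : Set ℝ} {v w : L2 E I} {G g : ℝ → E}
    (hG : IsPrimitive G g) (hv : v =ᵐ[volume.restrict I] G) (hw : w =ᵐ[volume.restrict I] g) :
    HasWeakDeriv v w := by
  intro φ hφ hc hs
  rw [integral_congr_ae (g := fun x => deriv φ x • G x), integral_deriv_smul_primitive hG hφ hc hs]
  · congr 1
    refine integral_congr_ae ?_
    filter_upwards [hw] with x hx
    rw [hx]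
  · filter_upwards [hv] with x hx
    rw [hx]

/-- The difference of `v` and a primitive of `w`, extended by zero, has zero weak derivative and is
therefore constant. The representative is continuous on all of `ℝ`, in particular at the endpoint
`0`. -/
theorem HasWeakDeriv.exists_isPrimitive {I : Set ℝ} (hI : IsOpen I) (hc : OrdConnected I)
    (hne : I.Nonempty) {v w : L2 E I} (h : HasWeakDeriv v w) :
    ∃ G : ℝ → E, IsPrimitive G (I.indicator w) ∧ v =ᵐ[volume.restrict I] G := by
  have hlw : LocallyIntegrable (I.indicator w) volume :=
    (memLp_indicator hI.measurableSet w).locallyIntegrable (by norm_num)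
  have hG := isPrimitive_integral hlw (0 : E)
  have hlv : LocallyIntegrable v (volume.restrict I) :=
    (Lp.memLp v).locallyIntegrable (by norm_num)
  have hlG := hG.continuous.locallyIntegrable (μ := volume.restrict I)
  obtain ⟨c, hc⟩ := ae_eq_const_of_integral_deriv_smul_eq_zero hI hc hne (hlv.sub hlG)
    fun φ hφ hφc hφs => by
      have hd : Continuous (deriv φ) := hφ.continuous_deriv (by simp)
      simp_rw [Pi.sub_apply, smul_sub]
      rw [integral_sub (hlv.integrable_smul_left_of_hasCompactSupport hd hφc.deriv)
        (hlG.integrable_smul_left_of_hasCompactSupport hd hφc.deriv), h φ hφ hφc hφs,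
        integral_deriv_smul_primitive hG hφ hφc hφs, sub_neg_eq_add, neg_add_eq_zero]
      refine setIntegral_congr_fun hI.measurableSet fun x hx => ?_
      rw [indicator_of_mem hx]
  refine ⟨_, isPrimitive_integral hlw c, ?_⟩
  filter_upwards [hc] with x hx
  rw [← hx]
  simp

theorem HasBoundaryValue.eq_of_continuous {I : Set ℝ} (hI : IsOpen I) (h0 : (0 : ℝ) ∈ closure I)
    {v : L2 E I} {e : E} (h : HasBoundaryValue v e) {G : ℝ → E} (hG : Continuous G)
    (hv : v =ᵐ[volume.restrict I] G) : G 0 = e := by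
  obtain ⟨g, hg, hvg, rfl⟩ := h
  have h1 : EqOn G g I := Measure.eqOn_open_of_ae_eq (hv.symm.trans hvg) hI hG.continuousOn
    (hg.mono subset_closure)
  exact h1.of_subset_closure hG.continuousOn hg subset_closure subset_rfl h0

theorem hasBoundaryValue_of_continuous {I : Set ℝ} {v : L2 E I} {G : ℝ → E} (hG : Continuous G)
    (hv : v =ᵐ[volume.restrict I] G) : HasBoundaryValue v (G 0) :=
  ⟨G, hG.continuousOn, hv, rfl⟩

theorem HasWeakDeriv.exists_hasBoundaryValue {I : Set ℝ} (hI : IsOpen I) (hc : OrdConnected I)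
    (hne : I.Nonempty) {v w : L2 E I} (h : HasWeakDeriv v w) : ∃ e, HasBoundaryValue v e := by
  obtain ⟨G, hG, hv⟩ := h.exists_isPrimitive hI hc hne
  exact ⟨_, hasBoundaryValue_of_continuous hG.continuous hv⟩

/-- The inner product as a real bilinear map. -/
def innerRealBilin (E : Type*) [NormedAddCommGroup E] [InnerProductSpace ℂ E] :
    E →L[ℝ] E →L[ℝ] ℂ :=
  (isBoundedBilinearMap_inner (𝕜 := ℂ) (E := E)).toContinuousLinearMap

theorem innerRealBilin_apply (x y : E) : innerRealBilin E x y = ⟪x, y⟫_ℂ := rfl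

/-- Common part of integration by parts on both half-lines: `P` is the inner product of the
continuous representatives and `p` is its derivative. -/
theorem exists_isPrimitive_inner {I : Set ℝ} (hI : IsOpen I) (hc : OrdConnected I)
    (hne : I.Nonempty) (h0 : (0 : ℝ) ∈ closure I) {v w v' w' : L2 E I} {e e' : E}
    (h : HasWeakDeriv v w) (hb : HasBoundaryValue v e) (h' : HasWeakDeriv v' w')
    (hb' : HasBoundaryValue v' e') :
    ∃ P p : ℝ → ℂ, IsPrimitive P p ∧ IntegrableOn P I ∧ IntegrableOn p I ∧ P 0 = ⟪e, e'⟫_ℂ ∧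
      ∫ x in I, p x = ⟪w, v'⟫_ℂ + ⟪v, w'⟫_ℂ := by
  obtain ⟨G, hG, hv⟩ := h.exists_isPrimitive hI hc hne
  obtain ⟨G', hG', hv'⟩ := h'.exists_isPrimitive hI hc hne
  have hP := hG.bilin (innerRealBilin E) hG'
  have e1 : (fun x => ⟪v x, v' x⟫_ℂ) =ᵐ[volume.restrict I]
      fun x => innerRealBilin E (G x) (G' x) := by
    filter_upwards [hv, hv'] with x hx hx'
    rw [hx, hx', innerRealBilin_apply]
  have e2 : (fun x => ⟪w x, v' x⟫_ℂ + ⟪v x, w' x⟫_ℂ) =ᵐ[volume.restrict I]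
      fun x => innerRealBilin E (I.indicator w x) (G' x) +
        innerRealBilin E (G x) (I.indicator w' x) := by
    filter_upwards [hv, hv', ae_restrict_mem hI.measurableSet] with x hx hx' hxI
    rw [hx, hx', indicator_of_mem hxI, indicator_of_mem hxI, innerRealBilin_apply,
      innerRealBilin_apply]
  have i1 := L2.integrable_inner (𝕜 := ℂ) w v'
  have i2 := L2.integrable_inner (𝕜 := ℂ) v w'
  refine ⟨_, _, hP, (L2.integrable_inner (𝕜 := ℂ) v v').congr e1, (i1.add i2).congr e2, ?_, ?_⟩
  · rw [innerRealBilin_apply, hb.eq_of_continuous hI h0 hG.continuous hv,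
      hb'.eq_of_continuous hI h0 hG'.continuous hv']
  · rw [← integral_congr_ae e2, integral_add i1 i2, L2.inner_def, L2.inner_def]

theorem inner_weakDeriv_Ioi {v w v' w' : L2 E (Ioi 0)} {e e' : E}
    (h : HasWeakDeriv v w) (hb : HasBoundaryValue v e) (h' : HasWeakDeriv v' w')
    (hb' : HasBoundaryValue v' e') : ⟪w, v'⟫_ℂ + ⟪v, w'⟫_ℂ = -⟪e, e'⟫_ℂ := by
  obtain ⟨P, p, hP, iP, ip, hP0, hp⟩ := exists_isPrimitive_inner isOpen_Ioi ordConnected_Ioi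
    nonempty_Ioi (by simp) h hb h' hb'
  have ht := (intervalIntegral_tendsto_integral_Ioi 0 ip Filter.tendsto_id).const_add (P 0)
  have ht' : Filter.Tendsto P Filter.atTop (nhds (P 0 + ∫ x in Ioi 0, p x)) :=
    ht.congr fun x => (hP.eq_add 0 x).symm
  -- `P` has a limit at infinity because `p` is integrable, and the limit is zero because `P` itself
  -- is integrable.
  have h0 := IntegrableAtFilter.eq_zero_of_tendsto (μ := volume) ⟨Ioi 0, Filter.Ioi_mem_atTop 0, iP⟩
    (fun s hs => by
      obtain ⟨a, ha⟩ := Filter.mem_atTop_sets.1 hs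
      exact measure_mono_top (fun x hx => ha x hx) (Real.volume_Ici (a := a))) ht'
  rw [← hp, ← hP0]
  exact (neg_eq_of_add_eq_zero_right h0).symm

theorem inner_weakDeriv_Iio {v w v' w' : L2 E (Iio 0)} {e e' : E}
    (h : HasWeakDeriv v w) (hb : HasBoundaryValue v e) (h' : HasWeakDeriv v' w')
    (hb' : HasBoundaryValue v' e') : ⟪w, v'⟫_ℂ + ⟪v, w'⟫_ℂ = ⟪e, e'⟫_ℂ := by
  obtain ⟨P, p, hP, iP, ip, hP0, hp⟩ := exists_isPrimitive_inner isOpen_Iio ordConnected_Iio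
    nonempty_Iio (by simp) h hb h' hb'
  rw [← integrableOn_Iic_iff_integrableOn_Iio] at ip
  have ht := (intervalIntegral_tendsto_integral_Iic 0 ip Filter.tendsto_id).const_sub (P 0)
  have ht' : Filter.Tendsto P Filter.atBot (nhds (P 0 - ∫ x in Iic 0, p x)) :=
    ht.congr fun x => by rw [id, ← hP.2, sub_sub_cancel]
  have h0 := IntegrableAtFilter.eq_zero_of_tendsto (μ := volume) ⟨Iio 0, Filter.Iio_mem_atBot 0, iP⟩
    (fun s hs => by
      obtain ⟨a, ha⟩ := Filter.mem_atBot_sets.1 hs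
      exact measure_mono_top (fun x hx => ha x hx) (Real.volume_Iic (a := a))) ht'
  rw [← hp, ← hP0, ← integral_Iic_eq_integral_Iio]
  exact (sub_eq_zero.1 h0).symm

/-! ### Exponential solutions -/

/-- The function `x ↦ exp(-i z x) e`. -/
def expVec (z : ℂ) (e : E) (x : ℝ) : E := Complex.exp (-Complex.I * z * x) • e

theorem hasDerivAt_exp_mul (z : ℂ) (x : ℝ) :
    HasDerivAt (fun x : ℝ => Complex.exp (-Complex.I * z * x))
      (-Complex.I * z * Complex.exp (-Complex.I * z * x)) x := by
  have h1 : HasDerivAt (fun x : ℝ => -Complex.I * z * (x : ℂ)) (-Complex.I * z) x := by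
    simpa using (Complex.ofRealCLM.hasDerivAt (x := x)).const_mul (-Complex.I * z)
  simpa [mul_comm] using h1.cexp

theorem continuous_expVec (z : ℂ) (e : E) : Continuous (expVec z e) := by
  unfold expVec
  fun_prop

theorem isPrimitive_expVec (z : ℂ) (e : E) :
    IsPrimitive (expVec z e) (fun x => (-Complex.I * z) • expVec z e x) := by
  refine isPrimitive_of_hasDerivAt (fun x => ?_) ((continuous_expVec z e).const_smul _)
  rw [expVec, smul_smul]
  exact (hasDerivAt_exp_mul z x).smul_const e

theorem norm_exp_mul (z : ℂ) (x : ℝ) :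
    ‖Complex.exp (-Complex.I * z * x)‖ = Real.exp (z.im * x) := by
  rw [Complex.norm_exp]
  simp

/-- The factor `2` arises from `‖exp(-i z x)‖² = exp(2 (Im z) x)`. -/
theorem exists_expVec {I : Set ℝ} {z : ℂ}
    (hz : IntegrableOn (fun x : ℝ => Real.exp (2 * z.im * x)) I) (e : E) :
    ∃ v : L2 E I, v =ᵐ[volume.restrict I] expVec z e ∧
      HasWeakDeriv v ((-Complex.I * z) • v) ∧ HasBoundaryValue v e := by
  have hm : MemLp (expVec z e) 2 (volume.restrict I) := by
    rw [memLp_two_iff_integrable_sq_norm (continuous_expVec z e).aestronglyMeasurable]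
    refine (hz.mul_const (‖e‖ ^ 2)).congr (Filter.Eventually.of_forall fun x => ?_)
    simp only [expVec]
    rw [norm_smul, norm_exp_mul, mul_pow, ← Real.exp_nat_mul]
    congr 2
    push_cast
    ring
  have hv := hm.coeFn_toLp
  refine ⟨hm.toLp _, hv, hasWeakDeriv_of_isPrimitive (isPrimitive_expVec z e) hv ?_, ?_⟩
  · filter_upwards [Lp.coeFn_smul (-Complex.I * z) (hm.toLp _), hv] with x h1 h2
    rw [h1, Pi.smul_apply, h2]
  · have := hasBoundaryValue_of_continuous (continuous_expVec z e) hv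
    rwa [show expVec z e 0 = e by simp [expVec]] at this

theorem integrableOn_exp_Ioi {c : ℝ} (hc : c < 0) :
    IntegrableOn (fun x => Real.exp (c * x)) (Ioi 0) := integrableOn_exp_mul_Ioi hc 0

theorem integrableOn_exp_Iio {c : ℝ} (hc : 0 < c) :
    IntegrableOn (fun x => Real.exp (c * x)) (Iio 0) :=
  (integrableOn_exp_mul_Iic hc 0).mono_set Iio_subset_Iic_self

end SobolevInterval

/-! ### Convolution with an integrable kernel -/

section Convolution

/-- Cauchy–Schwarz for the factors `k^(1/2)` and `k^(1/2) h`. -/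
theorem lintegral_mul_sq_le {α : Type*} [MeasurableSpace α] {μ : Measure α} {k h : α → ℝ≥0∞}
    (hk : AEMeasurable k μ) (hh : AEMeasurable h μ) :
    (∫⁻ s, k s * h s ∂μ) ^ 2 ≤ (∫⁻ s, k s ∂μ) * ∫⁻ s, k s * h s ^ 2 ∂μ := by
  have h1 := ENNReal.lintegral_mul_le_Lp_mul_Lq μ Real.HolderConjugate.two_two
    (hk.pow_const (1 / 2 : ℝ)) ((hk.pow_const (1 / 2 : ℝ)).mul hh)
  have e0 : ∀ a : ℝ≥0∞, a ^ (1 / 2 : ℝ) * a ^ (1 / 2 : ℝ) = a := fun a => by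
    rw [← ENNReal.rpow_add_of_nonneg _ _ (by norm_num) (by norm_num)]
    norm_num
  have e2 : ∀ a : ℝ≥0∞, (a ^ (1 / 2 : ℝ)) ^ 2 = a := fun a => by rw [sq, e0]
  simp only [Pi.mul_apply, ENNReal.rpow_two, mul_pow, e2, ← mul_assoc, e0] at h1
  calc (∫⁻ s, k s * h s ∂μ) ^ 2 ≤
      ((∫⁻ s, k s ∂μ) ^ (1 / 2 : ℝ) * (∫⁻ s, k s * h s ^ 2 ∂μ) ^ (1 / 2 : ℝ)) ^ 2 := by gcongr
    _ = _ := by rw [mul_pow, e2, e2]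

/-- Young's inequality for the convolution of `L¹` and `L²`. -/
theorem lintegral_convolution_sq_le {k h : ℝ → ℝ≥0∞} (hk : AEMeasurable k) (hh : AEMeasurable h) :
    ∫⁻ x, (∫⁻ s, k (x - s) * h s) ^ 2 ≤ (∫⁻ x, k x) ^ 2 * ∫⁻ s, h s ^ 2 := by
  have hqx : ∀ x : ℝ, Measure.QuasiMeasurePreserving (fun s : ℝ => x - s) := fun x =>
    (Measure.measurePreserving_sub_left volume x).quasiMeasurePreserving
  have hh2 : AEMeasurable (fun p : ℝ × ℝ => h p.2) (volume.prod volume) :=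
    hh.comp_quasiMeasurePreserving Measure.quasiMeasurePreserving_snd
  have hk2 : AEMeasurable (fun p : ℝ × ℝ => k (p.1 - p.2)) (volume.prod volume) :=
    hk.comp_quasiMeasurePreserving (quasiMeasurePreserving_sub volume volume)
  -- Weighted Cauchy–Schwarz at each `x`, followed by Tonelli and translation invariance.
  calc ∫⁻ x, (∫⁻ s, k (x - s) * h s) ^ 2
      ≤ ∫⁻ x, (∫⁻ y, k y) * ∫⁻ s, k (x - s) * h s ^ 2 := by
        refine lintegral_mono fun x => ?_
        have := lintegral_mul_sq_le (hk.comp_quasiMeasurePreserving (hqx x)) hh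
        rw [← lintegral_sub_left_eq_self k x]
        exact this
    _ = (∫⁻ y, k y) * ∫⁻ x, ∫⁻ s, k (x - s) * h s ^ 2 := by
        rw [lintegral_const_mul'']
        exact (hk2.mul (hh2.pow_const 2)).lintegral_prod_right'
    _ = (∫⁻ y, k y) * ∫⁻ s, ∫⁻ x, k (x - s) * h s ^ 2 := by
        rw [lintegral_lintegral_swap]
        exact hk2.mul (hh2.pow_const 2)
    _ = (∫⁻ y, k y) * ∫⁻ s, (∫⁻ y, k y) * h s ^ 2 := by
        congr 1
        refine lintegral_congr fun s => ?_
        rw [lintegral_mul_const'', lintegral_sub_right_eq_self k s]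
        exact hk.comp_quasiMeasurePreserving
          (measurePreserving_sub_right volume s).quasiMeasurePreserving
    _ = (∫⁻ x, k x) ^ 2 * ∫⁻ s, h s ^ 2 := by
        rw [lintegral_const_mul'' _ (hh.pow_const 2), sq, mul_assoc]

variable {E : Type*} [NormedAddCommGroup E] [NormedSpace ℂ E] [CompleteSpace E]

theorem lintegral_enorm_sq_lt_top {f : ℝ → E} (hf : MemLp f 2) : ∫⁻ x, ‖f x‖ₑ ^ 2 < ⊤ := by
  have h := lintegral_rpow_enorm_lt_top_of_eLpNorm_lt_top two_ne_zero ENNReal.ofNat_ne_top hf.2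
  simpa using h

theorem aestronglyMeasurable_kernel_smul {k : ℝ → ℂ} (hk : Integrable k) {h : ℝ → E}
    (hh : MemLp h 2) :
    AEStronglyMeasurable (fun p : ℝ × ℝ => k (p.1 - p.2) • h p.2) (volume.prod volume) :=
  (hk.aestronglyMeasurable.comp_quasiMeasurePreserving
    (quasiMeasurePreserving_sub volume volume)).smul hh.1.comp_snd

theorem lintegral_kernel_lt_top {k : ℝ → ℂ} (hk : Integrable k) {h : ℝ → E} (hh : MemLp h 2) :
    ∫⁻ x, (∫⁻ s, ‖k (x - s)‖ₑ * ‖h s‖ₑ) ^ 2 < ⊤ := by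
  refine (lintegral_convolution_sq_le hk.1.enorm hh.1.enorm).trans_lt ?_
  exact ENNReal.mul_lt_top (ENNReal.pow_lt_top hk.2) (lintegral_enorm_sq_lt_top hh)

theorem memLp_convolution {k : ℝ → ℂ} (hk : Integrable k) {h : ℝ → E} (hh : MemLp h 2) :
    MemLp (fun x => ∫ s, k (x - s) • h s) 2 := by
  refine ⟨(aestronglyMeasurable_kernel_smul hk hh).integral_prod_right', ?_⟩
  rw [eLpNorm_lt_top_iff_lintegral_rpow_enorm_lt_top two_ne_zero ENNReal.ofNat_ne_top]
  simp only [ENNReal.toReal_ofNat, ENNReal.rpow_two]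
  refine (lintegral_mono fun x => ?_).trans_lt (lintegral_kernel_lt_top hk hh)
  gcongr
  refine (enorm_integral_le_lintegral_enorm _).trans (le_of_eq ?_)
  simp_rw [enorm_smul]

theorem integrable_test_kernel {k : ℝ → ℂ} (hk : Integrable k) {h : ℝ → E} (hh : MemLp h 2)
    {φ : ℝ → ℝ} (hφ : MemLp φ 2) :
    Integrable (fun p : ℝ × ℝ => φ p.1 • k (p.1 - p.2) • h p.2) (volume.prod volume) := by
  refine ⟨hφ.1.comp_fst.smul (aestronglyMeasurable_kernel_smul hk hh), ?_⟩
  have hm : AEMeasurable (fun p : ℝ × ℝ => ‖φ p.1 • k (p.1 - p.2) • h p.2‖ₑ)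
      (volume.prod volume) :=
    (hφ.1.comp_fst.smul (aestronglyMeasurable_kernel_smul hk hh)).enorm
  rw [hasFiniteIntegral_iff_enorm, lintegral_prod _ hm]
  have hφ2 : ∫⁻ x, ‖φ x‖ₑ ^ 2 < ⊤ := by
    have h := lintegral_rpow_enorm_lt_top_of_eLpNorm_lt_top two_ne_zero ENNReal.ofNat_ne_top hφ.2
    simpa using h
  refine lt_of_le_of_lt ?_ (ENNReal.add_lt_top.2 ⟨hφ2, lintegral_kernel_lt_top hk hh⟩)
  rw [← lintegral_add_left' (hφ.1.enorm.pow_const 2)]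
  refine lintegral_mono fun x => ?_
  simp only [enorm_smul]
  rw [lintegral_const_mul' _ _ enorm_ne_top]
  set a := ‖φ x‖ₑ
  set b := ∫⁻ s, ‖k (x - s)‖ₑ * ‖h s‖ₑ
  -- `a b` is at most the larger of `a²` and `b²`, hence at most `a² + b²`.
  rcases le_total a b with hab | hab
  · exact (mul_le_mul_left hab b).trans ((sq b).ge.trans le_add_self)
  · exact (mul_le_mul_right hab a).trans ((sq a).ge.trans le_self_add)

theorem integral_smul_kernel_smul (k : ℝ → ℂ) (ψ : ℝ → ℝ) (e : E) (s : ℝ) :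
    ∫ x, ψ x • k (x - s) • e = (∫ x, ψ (x + s) • k x) • e := by
  rw [← integral_add_right_eq_self _ s, ← integral_smul_const]
  congr 1
  ext x
  rw [add_sub_cancel_right, smul_assoc]

/-- If `k' = -i z k + δ` in the sense of distributions, then `v = k ∗ h` has the weak derivative
`h - i z v`. -/
theorem integral_deriv_smul_convolution {k : ℝ → ℂ} (hk : Integrable k) {z : ℂ}
    (hkz : ∀ φ : ℝ → ℝ, ContDiff ℝ ∞ φ → HasCompactSupport φ →
      ∫ x, φ x • (-Complex.I * z * k x) = -φ 0 - ∫ x, deriv φ x • k x)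
    {h : ℝ → E} (hh : MemLp h 2) {φ : ℝ → ℝ} (hφ : ContDiff ℝ ∞ φ) (hc : HasCompactSupport φ) :
    ∫ x, deriv φ x • ∫ s, k (x - s) • h s =
      -∫ x, φ x • (h x - (Complex.I * z) • ∫ s, k (x - s) • h s) := by
  have hd : Continuous (deriv φ) := hφ.continuous_deriv (by simp)
  have mφ : MemLp φ 2 := hφ.continuous.memLp_of_hasCompactSupport hc
  have md : MemLp (deriv φ) 2 := hd.memLp_of_hasCompactSupport hc.deriv
  have fub : ∀ ψ : ℝ → ℝ, MemLp ψ 2 → ∫ x, ψ x • ∫ s, k (x - s) • h s =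
      ∫ s, (∫ x, ψ (x + s) • k x) • h s := by
    intro ψ hψ
    calc ∫ x, ψ x • ∫ s, k (x - s) • h s = ∫ x, ∫ s, ψ x • k (x - s) • h s := by
          simp_rw [integral_smul]
      _ = ∫ s, ∫ x, ψ x • k (x - s) • h s :=
          integral_integral_swap (integrable_test_kernel hk hh hψ)
      _ = ∫ s, (∫ x, ψ (x + s) • k x) • h s := by
          refine integral_congr_ae (Filter.Eventually.of_forall fun s => ?_)
          exact integral_smul_kernel_smul k ψ (h s) s
  have ih : LocallyIntegrable h := hh.locallyIntegrable (by norm_num)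
  have iv : LocallyIntegrable (fun x => ∫ s, k (x - s) • h s) :=
    (memLp_convolution hk hh).locallyIntegrable (by norm_num)
  have i1 := ih.integrable_smul_left_of_hasCompactSupport hφ.continuous hc
  have i2 := iv.integrable_smul_left_of_hasCompactSupport hφ.continuous hc
  have e1 : ∫ x, φ x • (h x - (Complex.I * z) • ∫ s, k (x - s) • h s) =
      (∫ x, φ x • h x) - (Complex.I * z) • ∫ x, φ x • ∫ s, k (x - s) • h s := by
    simp_rw [smul_sub, smul_comm _ (Complex.I * z)]
    rw [integral_sub i1 (i2.fun_smul _), integral_smul]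
  have e2 : ∀ s, (∫ x, deriv φ (x + s) • k x) • h s =
      (Complex.I * z) • (∫ x, φ (x + s) • k x) • h s - φ s • h s := by
    intro s
    -- The distributional equation for `k` is tested with the translate of `φ` by `s`.
    have hs := hkz (fun x => φ (x + s)) (hφ.comp (contDiff_id.add contDiff_const))
      (hc.comp_homeomorph (Homeomorph.addRight s))
    simp only [deriv_comp_add_const, zero_add] at hs
    have hs' : ∫ x, φ (x + s) • (-Complex.I * z * k x) =
        (-Complex.I * z) * ∫ x, φ (x + s) • k x := by
      rw [← integral_const_mul]
      congr 1
      ext x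
      rw [mul_smul_comm]
    rw [hs'] at hs
    have : ∫ x, deriv φ (x + s) • k x =
        (Complex.I * z) * (∫ x, φ (x + s) • k x) - φ s := by linear_combination hs
    rw [this, sub_smul, mul_smul]
    rfl
  have i4 : Integrable fun s => (∫ x, φ (x + s) • k x) • h s := by
    have := (integrable_test_kernel hk hh mφ).integral_prod_right
    refine this.congr (Filter.Eventually.of_forall fun s => ?_)
    exact integral_smul_kernel_smul k φ (h s) s
  rw [e1, fub _ md, fub _ mφ]
  simp_rw [e2]
  rw [integral_sub (i4.fun_smul _) i1, integral_smul, neg_sub]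

end Convolution

/-! ### The equation `i v' - z v = h` on an interval -/

section Equation

/-- Fundamental theorem of calculus for `φ(x) exp(-i z x)`; compact support of `φ` removes the term
at infinity for every `z`. -/
theorem integral_test_exp {φ : ℝ → ℝ} (hφ : ContDiff ℝ ∞ φ) (hc : HasCompactSupport φ) (z : ℂ) :
    (∫ x in Ioi 0, (deriv φ x • Complex.exp (-Complex.I * z * x) +
        φ x • (-Complex.I * z * Complex.exp (-Complex.I * z * x)))) = -φ 0 ∧
      (∫ x in Iic 0, (deriv φ x • Complex.exp (-Complex.I * z * x) +
        φ x • (-Complex.I * z * Complex.exp (-Complex.I * z * x)))) = φ 0 := by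
  let P : ℝ → ℂ := fun x => φ x • Complex.exp (-Complex.I * z * x)
  have hP : ContDiff ℝ 1 P := by
    have h1 : ContDiff ℝ 1 φ := hφ.of_le (by exact_mod_cast le_top)
    have h2 : ContDiff ℝ 1 fun x : ℝ => Complex.exp (-Complex.I * z * x) :=
      (contDiff_const.mul Complex.ofRealCLM.contDiff).cexp
    exact h1.smul h2
  have hPc : HasCompactSupport P := hc.smul_right
  have hd : ∀ x, deriv P x = deriv φ x • Complex.exp (-Complex.I * z * x) +
      φ x • (-Complex.I * z * Complex.exp (-Complex.I * z * x)) := fun x => by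
    have h1 := (hφ.differentiable (by simp) x).hasDerivAt
    rw [show deriv P x = _ from (h1.smul (hasDerivAt_exp_mul z x)).deriv, add_comm]
  have h0 : P 0 = φ 0 := by simp [P]
  simp_rw [← hd, ← h0]
  exact ⟨hPc.integral_Ioi_deriv_eq hP 0, hPc.integral_Iic_deriv_eq hP 0⟩

theorem integrableOn_cexp {J : Set ℝ} {z : ℂ}
    (h : IntegrableOn (fun x : ℝ => Real.exp (z.im * x)) J) :
    IntegrableOn (fun x : ℝ => Complex.exp (-Complex.I * z * x)) J := by
  refine h.mono' (Continuous.aestronglyMeasurable (by fun_prop)) ?_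
  exact Filter.Eventually.of_forall fun x => (norm_exp_mul z x).le

/-- An integrable fundamental solution of `k' + i z k`. -/
theorem exists_kernel {z : ℂ} (hz : z.im ≠ 0) : ∃ k : ℝ → ℂ, Integrable k ∧
    ∀ φ : ℝ → ℝ, ContDiff ℝ ∞ φ → HasCompactSupport φ →
      ∫ x, φ x • (-Complex.I * z * k x) = -φ 0 - ∫ x, deriv φ x • k x := by
  have main : ∀ (J : Set ℝ) (c : ℂ), MeasurableSet J →
      IntegrableOn (fun x : ℝ => Real.exp (z.im * x)) J →
      (∀ φ : ℝ → ℝ, ContDiff ℝ ∞ φ → HasCompactSupport φ →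
        c * ∫ x in J, (deriv φ x • Complex.exp (-Complex.I * z * x) +
        φ x • (-Complex.I * z * Complex.exp (-Complex.I * z * x))) = -φ 0) →
      ∃ k : ℝ → ℂ, Integrable k ∧ ∀ φ : ℝ → ℝ, ContDiff ℝ ∞ φ → HasCompactSupport φ →
        ∫ x, φ x • (-Complex.I * z * k x) = -φ 0 - ∫ x, deriv φ x • k x := by
    intro J c hJ hi hJc
    have hk : Integrable (J.indicator fun x : ℝ => c * Complex.exp (-Complex.I * z * x)) :=
      (integrable_indicator_iff hJ).2 ((integrableOn_cexp hi).const_mul c)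
    refine ⟨_, hk, fun φ hφ hc => ?_⟩
    have hd : Continuous (deriv φ) := hφ.continuous_deriv (by simp)
    have i1 := hk.locallyIntegrable.integrable_smul_left_of_hasCompactSupport hd hc.deriv
    have i2 := (hk.const_mul (-Complex.I * z)).locallyIntegrable
      |>.integrable_smul_left_of_hasCompactSupport hφ.continuous hc
    rw [eq_sub_iff_add_eq, ← integral_add i2 i1, ← hJc φ hφ hc, ← integral_const_mul,
      ← integral_indicator hJ]
    congr 1
    ext x
    by_cases hx : x ∈ J
    · simp only [indicator_of_mem hx, Complex.real_smul]
      ring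
    · simp [indicator_of_notMem hx]
  -- The exponential is kept on the half-line where it decays; the constants `1` and `-1` give a
  -- unit upward jump at `0` in both cases.
  rcases lt_or_gt_of_ne hz with h | h
  · exact main (Ioi 0) 1 measurableSet_Ioi (integrableOn_exp_Ioi h)
      fun φ hφ hc => by rw [(integral_test_exp hφ hc z).1, one_mul]
  · exact main (Iic 0) (-1) measurableSet_Iic (integrableOn_exp_mul_Iic h 0)
      fun φ hφ hc => by rw [(integral_test_exp hφ hc z).2, neg_one_mul]

variable {E : Type*} [NormedAddCommGroup E] [InnerProductSpace ℂ E] [CompleteSpace E]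

/-- The equation reads `v' = -i z v - i h`, so `v` is the convolution of the kernel with `-i h`
extended by zero. -/
theorem exists_weak_solution {I : Set ℝ} (hI : MeasurableSet I) {z : ℂ} (hz : z.im ≠ 0)
    (h : L2 E I) : ∃ v w : L2 E I, HasWeakDeriv v w ∧ Complex.I • w - z • v = h := by
  obtain ⟨k, hk, hkz⟩ := exists_kernel hz
  have hm : MemLp (fun x => (-Complex.I) • I.indicator h x) 2 :=
    (memLp_indicator hI h).const_smul (-Complex.I)
  have hV := memLp_convolution hk hm
  set V := fun x => ∫ s, k (x - s) • (-Complex.I) • I.indicator h s with hVdef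
  have hV' : MemLp V 2 (volume.restrict I) := hV.restrict I
  have hv := hV'.coeFn_toLp
  refine ⟨hV'.toLp V, (-Complex.I) • (h + z • hV'.toLp V), ?_, ?_⟩
  · intro φ hφ hc hs
    have hds : tsupport (deriv φ) ⊆ I :=
      (closure_minimal support_deriv_subset (isClosed_tsupport φ)).trans hs
    have e1 : ∫ x in I, deriv φ x • hV'.toLp V x = ∫ x, deriv φ x • V x := by
      rw [← setIntegral_test_smul hds]
      refine integral_congr_ae ?_
      filter_upwards [hv] with x hx
      rw [hx]
    rw [e1, integral_deriv_smul_convolution hk hkz hm hφ hc,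
      ← setIntegral_test_smul (fun x hx => hs hx)]
    congr 1
    refine integral_congr_ae ?_
    filter_upwards [hv, Lp.coeFn_smul (-Complex.I) (h + z • hV'.toLp V),
      Lp.coeFn_add h (z • hV'.toLp V), Lp.coeFn_smul z (hV'.toLp V), ae_restrict_mem hI]
      with x h1 h2 h3 h4 h5
    rw [h2, Pi.smul_apply, h3, Pi.add_apply, h4, Pi.smul_apply, h1, indicator_of_mem h5, smul_add,
      smul_smul _ z, neg_mul, neg_smul (Complex.I * z), ← sub_eq_add_neg]
  · rw [smul_smul, mul_neg, Complex.I_mul_I, neg_neg, one_smul, add_sub_cancel_right]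

theorem exists_solution_boundary {I : Set ℝ} (hI : IsOpen I) (hc : OrdConnected I)
    (hne : I.Nonempty) {z : ℂ} (hz : z.im ≠ 0) (h : L2 E I) :
    ∃ (v w : L2 E I) (e : E), HasWeakDeriv v w ∧ HasBoundaryValue v e ∧
      Complex.I • w - z • v = h := by
  obtain ⟨v, w, h1, h2⟩ := exists_weak_solution hI.measurableSet hz h
  obtain ⟨e, he⟩ := h1.exists_hasBoundaryValue hI hc hne
  exact ⟨v, w, e, h1, he, h2⟩

/-- On this `I` the homogeneous solutions `exp(-i z x) e` are square integrable, so adding one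
adjusts the boundary value freely. -/
theorem exists_solution_of_boundary {I : Set ℝ} (hI : IsOpen I) (hc : OrdConnected I)
    (hne : I.Nonempty) {z : ℂ} (hz : z.im ≠ 0)
    (hexp : IntegrableOn (fun x : ℝ => Real.exp (2 * z.im * x)) I) (h : L2 E I) (e : E) :
    ∃ (v w : L2 E I), HasWeakDeriv v w ∧ HasBoundaryValue v e ∧
      Complex.I • w - z • v = h := by
  obtain ⟨v, w, e', h1, h2, h3⟩ := exists_solution_boundary hI hc hne hz h
  obtain ⟨y, -, hy, hy'⟩ := exists_expVec hexp (e - e')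
  refine ⟨v + y, _, h1.add hy, by simpa using h2.add hy', ?_⟩
  rw [← h3, smul_add, smul_smul, ← mul_assoc, mul_neg, Complex.I_mul_I, neg_neg, one_mul, smul_add]
  abel

end Equation

/-! ### Completeness of the exponentials -/

section Completeness

open FourierTransform in
-- Each test function is the Fourier transform of a Schwartz function `χ`, and `∫ 𝓕χ • f = ∫ χ • 𝓕f
-- = 0`.
theorem ae_eq_zero_of_fourier_eq_zero {E : Type*} [NormedAddCommGroup E] [NormedSpace ℂ E]
    [CompleteSpace E] {f : ℝ → E} (hf : Integrable f) (h : ∀ ξ, 𝓕 f ξ = 0) :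
    ∀ᵐ x, f x = 0 := by
  refine ae_eq_zero_of_integral_contDiff_smul_eq_zero hf.locallyIntegrable fun g hg hgc => ?_
  have hg₁ : HasCompactSupport (Complex.ofRealCLM ∘ g) := hgc.comp_left rfl
  have hg₂ : ContDiff ℝ ∞ (Complex.ofRealCLM ∘ g) := by fun_prop
  let ψ := hg₁.toSchwartzMap hg₂
  let χ : SchwartzMap ℝ ℂ := 𝓕⁻ ψ
  have hψ : 𝓕 χ = ψ := FourierTransform.fourier_fourierInv_eq ψ
  have h1 := VectorFourier.integral_fourierIntegral_smul_eq_flip (L := innerₗ ℝ)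
    (μ := volume) (ν := volume) Real.continuous_fourierChar continuous_inner
    χ.integrable hf
  have h2 : ∀ ξ, VectorFourier.fourierIntegral Real.fourierChar volume (innerₗ ℝ).flip f ξ = 0 := by
    intro ξ
    rw [← h ξ, Real.fourier_eq, VectorFourier.fourierIntegral]
    simp
  have h3 : ∀ x, VectorFourier.fourierIntegral Real.fourierChar volume (innerₗ ℝ) χ x =
      (g x : ℂ) := by
    intro x
    have h4 : (𝓕 χ) x = (g x : ℂ) := by rw [hψ]; rfl
    rw [← h4, SchwartzMap.fourier_coe]
    rfl
  simp only [h2, h3, smul_zero, integral_zero] at h1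
  exact h1

variable {E : Type*} [NormedAddCommGroup E] [InnerProductSpace ℂ E] [CompleteSpace E]

theorem eq_zero_of_orthogonal_expVec {I : Set ℝ} (hI : MeasurableSet I) {τ : ℝ}
    (hτ : IntegrableOn (fun x : ℝ => Real.exp (2 * τ * x)) I) {y : L2 E I}
    (h : ∀ z : ℂ, z.im = τ → ∀ (e : E) (v : L2 E I), v =ᵐ[volume.restrict I] expVec z e →
      ⟪v, y⟫_ℂ = 0) : y = 0 := by
  have hm : MemLp (fun x : ℝ => Real.exp (τ * x)) 2 (volume.restrict I) := by
    rw [memLp_two_iff_integrable_sq_norm (Continuous.aestronglyMeasurable (by fun_prop))]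
    refine hτ.congr (Filter.Eventually.of_forall fun x => ?_)
    simp only [Real.norm_eq_abs, Real.abs_exp]
    rw [← Real.exp_nat_mul]
    congr 1
    push_cast
    ring
  have hf : IntegrableOn (fun x : ℝ => Real.exp (τ * x) • y x) I :=
    memLp_one_iff_integrable.1 (MemLp.smul (𝕜 := ℝ) (r := 1) (Lp.memLp y) hm)
  have hF : Integrable (I.indicator fun x : ℝ => Real.exp (τ * x) • y x) :=
    (integrable_indicator_iff hI).2 hf
  have key := ae_eq_zero_of_fourier_eq_zero hF fun ξ => by
    refine ext_inner_left ℂ fun e => ?_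
    rw [inner_zero_right, Real.fourier_eq, ← integral_inner]
    · have hz : (-(2 * Real.pi * ξ : ℝ) + τ * Complex.I : ℂ).im = τ := by simp
      obtain ⟨v, hv, -⟩ := exists_expVec (I := I) (z := -(2 * Real.pi * ξ : ℝ) + τ * Complex.I)
        (by rwa [hz]) e
      rw [← h _ hz e v hv, L2.inner_def, ← integral_indicator hI]
      have hv' := (ae_restrict_iff' hI).1 hv
      refine integral_congr_ae ?_
      filter_upwards [hv'] with x hx
      by_cases hxI : x ∈ I
      · rw [indicator_of_mem hxI, indicator_of_mem hxI, hx hxI, expVec, inner_smul_left,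
          Circle.smul_def, inner_smul_right, inner_smul_right_eq_smul, Complex.real_smul,
          ← mul_assoc]
        congr 1
        rw [Real.fourierChar_apply, ← Complex.exp_conj, Complex.ofReal_exp, ← Complex.exp_add]
        congr 1
        apply Complex.ext
        · simp
        · simp
          ring
      · rw [indicator_of_notMem hxI, indicator_of_notMem hxI, smul_zero, inner_zero_right]
    · exact (Real.fourierIntegral_convergent_iff ξ).2 hF
  refine (Lp.eq_zero_iff_ae_eq_zero).2 ?_
  refine (ae_restrict_iff' hI).2 ?_
  filter_upwards [key] with x hx hxI
  rw [indicator_of_mem hxI] at hx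
  exact (smul_eq_zero.1 hx).resolve_left (Real.exp_pos _).ne'

end Completeness

/-! ### The dilation -/

section DilationProof

variable {H E : Type*} [NormedAddCommGroup H] [InnerProductSpace ℂ H] [CompleteSpace H]
  [NormedAddCommGroup E] [InnerProductSpace ℂ E] [CompleteSpace E]

theorem inner_vec (a a' : L2 E (Iio 0)) (b b' : H) (c c' : L2 E (Ioi 0)) :
    ⟪vec a b c, vec a' b' c'⟫_ℂ = ⟪a, a'⟫_ℂ + (⟪b, b'⟫_ℂ + ⟪c, c'⟫_ℂ) := by
  rw [WithLp.prod_inner_apply, WithLp.prod_inner_apply]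

theorem exists_eq_vec (x : DilationSpace H E) : ∃ a b c, x = vec a b c :=
  ⟨x.fst, x.snd.fst, x.snd.snd, rfl⟩

theorem smul_vec (z : ℂ) (a : L2 E (Iio 0)) (b : H) (c : L2 E (Ioi 0)) :
    z • vec a b c = vec (z • a) (z • b) (z • c) := rfl

theorem sub_vec (a a' : L2 E (Iio 0)) (b b' : H) (c c' : L2 E (Ioi 0)) :
    vec a b c - vec a' b' c' = vec (a - a') (b - b') (c - c') := rfl

theorem inner_embed (h : H) (x : DilationSpace H E) : ⟪embed H E h, x⟫_ℂ = ⟪h, x.snd.fst⟫_ℂ := by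
  have := inner_vec (0 : L2 E (Iio 0)) x.fst h x.snd.fst (0 : L2 E (Ioi 0)) x.snd.snd
  rw [inner_zero_left, inner_zero_left, zero_add, add_zero] at this
  exact this

theorem adjoint_embed_apply (x : DilationSpace H E) :
    ContinuousLinearMap.adjoint (embed H E).toContinuousLinearMap x = x.snd.fst := by
  refine ext_inner_left ℂ fun h => ?_
  rw [ContinuousLinearMap.adjoint_inner_right]
  exact inner_embed h x

theorem sqrt_two_sq : ((Real.sqrt 2 : ℝ) : ℂ) * (Real.sqrt 2 : ℝ) = 2 := by
  rw [← Complex.ofReal_mul, Real.mul_self_sqrt (by norm_num)]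
  norm_num

theorem sqrt_two_ne_zero : ((Real.sqrt 2 : ℝ) : ℂ) ≠ 0 := fun h => by
  have := sqrt_two_sq
  rw [h, mul_zero] at this
  norm_num at this

/-- Polarised form of `‖a + i b‖² - ‖a - i b‖²`; its factor `2` is absorbed by the two factors `√2`.
-/
theorem boundary_identity {a b a' b' em ep em' ep' : E}
    (hm : a - Complex.I • b = (Real.sqrt 2 : ℂ) • em)
    (hp : a + Complex.I • b = (Real.sqrt 2 : ℂ) • ep)
    (hm' : a' - Complex.I • b' = (Real.sqrt 2 : ℂ) • em')
    (hp' : a' + Complex.I • b' = (Real.sqrt 2 : ℂ) • ep') :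
    ⟪ep, ep'⟫_ℂ - ⟪em, em'⟫_ℂ = Complex.I * (⟪a, b'⟫_ℂ - ⟪b, a'⟫_ℂ) := by
  have h : ∀ x y : E, ⟪(Real.sqrt 2 : ℂ) • x, (Real.sqrt 2 : ℂ) • y⟫_ℂ = 2 * ⟪x, y⟫_ℂ := by
    intro x y
    rw [inner_smul_left, inner_smul_right, Complex.conj_ofReal, ← mul_assoc, sqrt_two_sq]
  have h1 := h em em'
  have h2 := h ep ep'
  rw [← hm, ← hm'] at h1
  rw [← hp, ← hp'] at h2
  simp only [inner_sub_left, inner_sub_right, inner_add_left, inner_add_right, inner_smul_left,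
    inner_smul_right, Complex.conj_I] at h1 h2
  linear_combination (h1 - h2) / 2

namespace Triple

variable (t : Triple H E)

theorem dilation_symmetric (x y : t.dilation.domain) :
    ⟪t.dilation x, (y : DilationSpace H E)⟫_ℂ = ⟪(x : DilationSpace H E), t.dilation y⟫_ℂ := by
  obtain ⟨x, hx⟩ := x
  obtain ⟨y, hy⟩ := y
  obtain ⟨vm, u, vp, rfl⟩ := exists_eq_vec x
  obtain ⟨vm', u', vp', rfl⟩ := exists_eq_vec y
  obtain ⟨wm, wp, em, ep, hu, h1, h2, h3, h4, h5, h6, h7⟩ :=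
    t.mem_graph_dilation.1 (LinearPMap.mem_graph t.dilation ⟨_, hx⟩)
  obtain ⟨wm', wp', em', ep', hu', k1, k2, k3, k4, k5, k6, k7⟩ :=
    t.mem_graph_dilation.1 (LinearPMap.mem_graph t.dilation ⟨_, hy⟩)
  rw [h7, k7, inner_vec, inner_vec]
  have g1 := inner_weakDeriv_Iio h1 h2 k1 k2
  have g2 := inner_weakDeriv_Ioi h3 h4 k3 k4
  have g3 := t.green hu hu'
  have g4 := boundary_identity h5 h6 k5 k6
  simp only [inner_smul_left, inner_smul_right, Complex.conj_I]
  linear_combination -Complex.I * g1 - Complex.I * g2 + g3 + Complex.I * g4 +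
    (⟪t.Γ₁ ⟨_, hu⟩, t.Γ₀ ⟨_, t.Γ₁_domain_le_Γ₀ hu'⟩⟫_ℂ -
      ⟪t.Γ₀ ⟨_, t.Γ₁_domain_le_Γ₀ hu⟩, t.Γ₁ ⟨_, hu'⟩⟫_ℂ) * Complex.I_sq

theorem exists_dilation_apply {z : ℂ} {vm wm : L2 E (Iio 0)} {vp wp : L2 E (Ioi 0)} {em ep : E}
    {u h : H} (hu : u ∈ t.Γ₁.domain) (h1 : HasWeakDeriv vm wm) (h2 : HasBoundaryValue vm em)
    (h3 : HasWeakDeriv vp wp) (h4 : HasBoundaryValue vp ep)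
    (h5 : t.Γ₁ ⟨u, hu⟩ - Complex.I • t.Γ₀ ⟨u, t.Γ₁_domain_le_Γ₀ hu⟩ = (Real.sqrt 2 : ℂ) • em)
    (h6 : t.Γ₁ ⟨u, hu⟩ + Complex.I • t.Γ₀ ⟨u, t.Γ₁_domain_le_Γ₀ hu⟩ = (Real.sqrt 2 : ℂ) • ep)
    (h7 : t.A ⟨u, t.Γ₁_domain_le_A hu⟩ - z • u = h) :
    ∃ hx : vec vm u vp ∈ t.dilation.domain, t.dilation ⟨vec vm u vp, hx⟩ - z • vec vm u vp =
      vec (Complex.I • wm - z • vm) h (Complex.I • wp - z • vp) := by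
  have hg := t.mem_graph_dilation.2 ⟨wm, wp, em, ep, hu, h1, h2, h3, h4, h5, h6, rfl⟩
  have hx : vec vm u vp ∈ t.dilation.domain := LinearPMap.mem_domain_of_mem_graph hg
  exact ⟨hx, by rw [apply_eq_of_mem_graph hg hx, smul_vec, sub_vec, h7]⟩

/-- For `Im z < 0` the exponentials decay on `ℝ₊`, so `v₊` can meet its boundary condition whatever
`u` is. -/
theorem exists_dilation_apply_lower {z : ℂ} (hz : z.im < 0) {vm wm : L2 E (Iio 0)} {em : E}
    {u h : H} (hu : u ∈ t.Γ₁.domain) (h1 : HasWeakDeriv vm wm) (h2 : HasBoundaryValue vm em)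
    (h5 : t.Γ₁ ⟨u, hu⟩ - Complex.I • t.Γ₀ ⟨u, t.Γ₁_domain_le_Γ₀ hu⟩ = (Real.sqrt 2 : ℂ) • em)
    (h7 : t.A ⟨u, t.Γ₁_domain_le_A hu⟩ - z • u = h) (hp : L2 E (Ioi 0)) :
    ∃ (vp : L2 E (Ioi 0)) (hx : vec vm u vp ∈ t.dilation.domain),
      t.dilation ⟨vec vm u vp, hx⟩ - z • vec vm u vp = vec (Complex.I • wm - z • vm) h hp := by
  obtain ⟨vp, wp, h3, h4, rfl⟩ := exists_solution_of_boundary isOpen_Ioi ordConnected_Ioi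
    nonempty_Ioi hz.ne (integrableOn_exp_Ioi (by linarith)) hp ((Real.sqrt 2 : ℂ)⁻¹ •
      (t.Γ₁ ⟨u, hu⟩ + Complex.I • t.Γ₀ ⟨u, t.Γ₁_domain_le_Γ₀ hu⟩))
  exact ⟨vp, t.exists_dilation_apply hu h1 h2 h3 h4 h5
    (by rw [smul_inv_smul₀ sqrt_two_ne_zero]) h7⟩

theorem exists_dilation_apply_upper {z : ℂ} (hz : 0 < z.im) {vp wp : L2 E (Ioi 0)} {ep : E}
    {u h : H} (hu : u ∈ t.Γ₁.domain) (h3 : HasWeakDeriv vp wp) (h4 : HasBoundaryValue vp ep)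
    (h6 : t.Γ₁ ⟨u, hu⟩ + Complex.I • t.Γ₀ ⟨u, t.Γ₁_domain_le_Γ₀ hu⟩ = (Real.sqrt 2 : ℂ) • ep)
    (h7 : t.A ⟨u, t.Γ₁_domain_le_A hu⟩ - z • u = h) (hm : L2 E (Iio 0)) :
    ∃ (vm : L2 E (Iio 0)) (hx : vec vm u vp ∈ t.dilation.domain),
      t.dilation ⟨vec vm u vp, hx⟩ - z • vec vm u vp = vec hm h (Complex.I • wp - z • vp) := by
  obtain ⟨vm, wm, h1, h2, rfl⟩ := exists_solution_of_boundary isOpen_Iio ordConnected_Iio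
    nonempty_Iio hz.ne' (integrableOn_exp_Iio (by linarith)) hm ((Real.sqrt 2 : ℂ)⁻¹ •
      (t.Γ₁ ⟨u, hu⟩ - Complex.I • t.Γ₀ ⟨u, t.Γ₁_domain_le_Γ₀ hu⟩))
  exact ⟨vm, t.exists_dilation_apply hu h1 h2 h3 h4
    (by rw [smul_inv_smul₀ sqrt_two_ne_zero]) h6 h7⟩

theorem dilation_surjective {z : ℂ} (hz : z.im ≠ 0) (y : DilationSpace H E) :
    ∃ x : t.dilation.domain, t.dilation x - z • (x : DilationSpace H E) = y := by
  rcases lt_or_gt_of_ne hz with h | h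
  -- For `Im z < 0` the system is triangular: `v₋` supplies `em`, this is the datum for `u`, and `u`
  -- fixes the boundary value of `v₊`. For `Im z > 0` the order is reversed.
  · obtain ⟨vm, wm, em, h1, h2, h3⟩ :=
      exists_solution_boundary isOpen_Iio ordConnected_Iio nonempty_Iio hz y.fst
    obtain ⟨u, hu, k1, k2⟩ := t.exists_solution (z := z) (σ := Complex.I) (by simpa) y.snd.fst
      ((Real.sqrt 2 : ℂ) • em)
    obtain ⟨vp, hx, hy⟩ := t.exists_dilation_apply_lower h hu h1 h2 k2 k1 y.snd.snd
    exact ⟨⟨_, hx⟩, hy.trans (by rw [h3]; rfl)⟩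
  · obtain ⟨vp, wp, ep, h1, h2, h3⟩ :=
      exists_solution_boundary isOpen_Ioi ordConnected_Ioi nonempty_Ioi hz y.snd.snd
    obtain ⟨u, hu, k1, k2⟩ := t.exists_solution (z := z) (σ := -Complex.I) (by simpa) y.snd.fst
      ((Real.sqrt 2 : ℂ) • ep)
    rw [neg_smul, sub_neg_eq_add] at k2
    obtain ⟨vm, hx, hy⟩ := t.exists_dilation_apply_upper h hu h1 h2 k2 k1 y.fst
    exact ⟨⟨_, hx⟩, hy.trans (by rw [h3]; rfl)⟩

theorem isSelfAdjoint_dilation : IsSelfAdjoint t.dilation :=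
  isSelfAdjoint_of_symmetric_of_surjective t.dilation_symmetric
    fun _ hz y => t.dilation_surjective hz y

theorem mem_resSet_dilation {z : ℂ} (hz : z.im ≠ 0) : z ∈ resSet t.dilation :=
  mem_resSet_of_symmetric t.dilation_symmetric hz fun y => t.dilation_surjective hz y

theorem isSelfAdjointDilation : IsSelfAdjointDilation (embed H E) t.dilation t.L := by
  refine ⟨t.isSelfAdjoint_dilation, fun z hz =>
    ⟨t.mem_resSet_dilation hz.ne, t.mem_resSet_L hz, fun h => ?_⟩⟩
  obtain ⟨u, hu, k1, k2⟩ := t.exists_solution (z := z) (σ := Complex.I) (by simpa) h 0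
  -- With no source on `ℝ₋` the choice `v₋ = 0` works, and the incoming boundary condition becomes
  -- that of `L`.
  obtain ⟨vp, hx, hy⟩ := t.exists_dilation_apply_lower hz hu (HasWeakDeriv.zero (E := E))
    HasBoundaryValue.zero (by rw [k2, smul_zero]) k1 0
  have hy' : t.dilation ⟨_, hx⟩ - z • vec 0 u vp = embed H E h := by
    rw [hy, smul_zero, smul_zero, sub_zero]
    rfl
  have h1 := (isResolventAt_res (t.mem_resSet_dilation hz.ne)).2 ⟨_, hx⟩
  rw [hy'] at h1
  rw [h1, adjoint_embed_apply, t.res_L_eq_of_solution hz hu k1 k2]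
  rfl

/-- A vector orthogonal to all `(𝒜 - z)⁻¹ h`, `h ∈ H`, is mapped by every resolvent of `𝒜` to a
vector with vanishing component in `H`. -/
theorem exists_of_orthogonal {y : DilationSpace H E}
    (hy : ∀ z : ℂ, z.im ≠ 0 → ∀ h : H, ⟪res t.dilation z (embed H E h), y⟫_ℂ = 0)
    {w : ℂ} (hw : w.im ≠ 0) :
    ∃ (vm wm : L2 E (Iio 0)) (vp wp : L2 E (Ioi 0)), HasWeakDeriv vm wm ∧
      HasBoundaryValue vm 0 ∧ HasWeakDeriv vp wp ∧ HasBoundaryValue vp 0 ∧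
      y = vec (Complex.I • wm - w • vm) 0 (Complex.I • wp - w • vp) := by
  have hw' : (conj w).im ≠ 0 := by simpa using hw
  obtain ⟨hb, hby⟩ := (isResolventAt_res (t.mem_resSet_dilation hw)).1 y
  obtain ⟨vm, u, vp, hv⟩ := exists_eq_vec (res t.dilation w y)
  obtain rfl : u = 0 := by
    refine ext_inner_left ℂ fun h => ?_
    have h1 := inner_res_of_isSelfAdjoint t.isSelfAdjoint_dilation (t.mem_resSet_dilation hw')
      (by rw [Complex.conj_conj]; exact t.mem_resSet_dilation hw) (embed H E h) y
    rw [hy _ hw', Complex.conj_conj, hv, inner_embed] at h1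
    exact h1.symm.trans (inner_zero_right h).symm
  have hg : (vec vm 0 vp, y + w • vec vm 0 vp) ∈ t.dilation.graph := by
    rw [← hv, ← sub_eq_iff_eq_add.1 hby]
    exact LinearPMap.mem_graph t.dilation ⟨_, hb⟩
  obtain ⟨wm, wp, em, ep, hu, h1, h2, h3, h4, h5, h6, h7⟩ := t.mem_graph_dilation.1 hg
  -- Since the component in `H` is zero, both boundary conditions reduce to vanishing boundary
  -- values.
  rw [apply_mk_eq_zero t.Γ₁ _ rfl, apply_mk_eq_zero t.Γ₀ _ rfl, smul_zero, sub_zero, eq_comm,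
    smul_eq_zero] at h5
  rw [apply_mk_eq_zero t.Γ₁ _ rfl, apply_mk_eq_zero t.Γ₀ _ rfl, smul_zero, add_zero, eq_comm,
    smul_eq_zero] at h6
  obtain rfl := h5.resolve_left sqrt_two_ne_zero
  obtain rfl := h6.resolve_left sqrt_two_ne_zero
  refine ⟨vm, wm, vp, wp, h1, h2, h3, h4, ?_⟩
  rw [eq_sub_of_add_eq h7, apply_mk_eq_zero t.A _ rfl, smul_vec, sub_vec, smul_zero, sub_zero]

/-- Each outer component of `y` equals `i v' - z̄ v` with `v(0) = 0`, for every non-real `z`; by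
parts it is orthogonal to `exp(-i z x) e` whenever that is square integrable. A single line `Im z =
τ` suffices: `τ = 1` on `ℝ₋`, `τ = -1` on `ℝ₊`. -/
theorem eq_zero_of_orthogonal {y : DilationSpace H E}
    (hy : ∀ z : ℂ, z.im ≠ 0 → ∀ h : H, ⟪res t.dilation z (embed H E h), y⟫_ℂ = 0) : y = 0 := by
  have alg : ∀ {I : Set ℝ} {v vp wp : L2 E I} {z : ℂ},
      ⟪(-Complex.I * z) • v, vp⟫_ℂ + ⟪v, wp⟫_ℂ = 0 →
        ⟪v, Complex.I • wp - conj z • vp⟫_ℂ = 0 := by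
    intro I v vp wp z h
    simp only [inner_smul_left, map_mul, map_neg, Complex.conj_I] at h
    rw [inner_sub_right, inner_smul_right, inner_smul_right]
    linear_combination Complex.I * h - conj z * ⟪v, vp⟫_ℂ * Complex.I_sq
  have hm : y.fst = 0 := by
    refine eq_zero_of_orthogonal_expVec measurableSet_Iio (τ := 1)
      (integrableOn_exp_Iio (by norm_num)) fun z hz e v hv => ?_
    obtain ⟨v', h1, h2, h3⟩ := exists_expVec (I := Iio 0) (z := z)
      (integrableOn_exp_Iio (by rw [hz]; norm_num)) e
    obtain rfl : v' = v := Lp.ext (h1.trans hv.symm)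
    obtain ⟨vm, wm, vp, wp, k1, k2, k3, k4, rfl⟩ :=
      t.exists_of_orthogonal hy (w := conj z) (by rw [Complex.conj_im, hz]; norm_num)
    exact alg ((inner_weakDeriv_Iio h2 h3 k1 k2).trans (inner_zero_right _))
  have hp : y.snd.snd = 0 := by
    refine eq_zero_of_orthogonal_expVec measurableSet_Ioi (τ := -1)
      (integrableOn_exp_Ioi (by norm_num)) fun z hz e v hv => ?_
    obtain ⟨v', h1, h2, h3⟩ := exists_expVec (I := Ioi 0) (z := z)
      (integrableOn_exp_Ioi (by rw [hz]; norm_num)) e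
    obtain rfl : v' = v := Lp.ext (h1.trans hv.symm)
    obtain ⟨vm, wm, vp, wp, k1, k2, k3, k4, rfl⟩ :=
      t.exists_of_orthogonal hy (w := conj z) (by rw [Complex.conj_im, hz]; norm_num)
    exact alg ((inner_weakDeriv_Ioi h2 h3 k3 k4).trans (by rw [inner_zero_right, neg_zero]))
  have hu : y.snd.fst = 0 := by
    obtain ⟨vm, wm, vp, wp, k1, k2, k3, k4, rfl⟩ :=
      t.exists_of_orthogonal hy (w := Complex.I) (by simp)
    rfl
  change vec y.fst y.snd.fst y.snd.snd = 0
  rw [hm, hu, hp]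
  rfl

theorem isMinimalOver_dilation : IsMinimalOver (embed H E) t.dilation := by
  refine ⟨fun z hz => t.mem_resSet_dilation hz, ?_⟩
  rw [Submodule.topologicalClosure_eq_top_iff, Submodule.eq_bot_iff]
  intro y hy
  rw [Submodule.mem_orthogonal] at hy
  exact t.eq_zero_of_orthogonal fun z hz h => hy _ (Submodule.subset_span ⟨z, hz, h, rfl⟩)

end Triple

end DilationProof

end BVPModel

open BVPModel in
theorem mainTheorem4 {H E : Type*}
    [NormedAddCommGroup H] [InnerProductSpace ℂ H] [CompleteSpace H]
    [NormedAddCommGroup E] [InnerProductSpace ℂ E] [CompleteSpace E] (t : Triple H E) :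
    IsMaximalDissipative t.L ∧
    (∀ z : ℂ, z.im < 0 → z ∈ resSet t.A₀ ∧ Complex.I ∈ resSet (t.M z) ∧
      res t.L z = res t.A₀ z -
        t.γ z ∘L res (t.M z) Complex.I ∘L
          ContinuousLinearMap.adjoint (t.γ (starRingEnd ℂ z))) ∧
    IsSelfAdjointDilation (embed H E) t.dilation t.L ∧
    IsMinimalOver (embed H E) t.dilation :=
  ⟨t.isMaximalDissipative_L, fun _ hz => t.res_L_eq hz, t.isSelfAdjointDilation,
    t.isMinimalOver_dilation⟩
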